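/- Let $m\ge 2$, $N\ge 0$ be integers and $\ell\in\mathbb C$. Let $\mathfrak h=\bar{\mathfrak h}\oplus\mathbb C c\oplus\mathbb C d$ be the Cartan subalgebra of $\widehat{\mathfrak{sl}}_m(\mathbb C)$, where $\bar{\mathfrak h}$ consists of the diagonal trace-zero matrices, and let $\bar\lambda=\lambda|_{\bar{\mathfrak h}}$ for $\lambda\in\mathfrak h^*$. Let $\bar e_a\in\bar{\mathfrak h}^*$ $(1\le a\le m)$ be the $a$-th diagonal entry (extended to $\mathfrak h$ by zero on $c,d$), and let $c^*,\delta\in\mathfrak h^*$ vanish on $\bar{\mathfrak h}$ with $c^*(c)=\delta(d)=1$, $c^*(d)=\delta(c)=0$. The simple roots are $\gamma_0=\delta-(\bar e_1-\bar e_m)$, $\gamma_i=\bar e_i-\bar e_{i+1}$ $(1\le i<m)$, and the simple coroots are $\gamma_0^\vee=c-(E_{11}-E_{mm})$, $\gamma_i^\vee=E_{ii}-E_{i+1,i+1}$. Let $W_{\mathfrak g}$ be the affine Weyl group, generated by the reflections $\sigma_i(\lambda)=\lambda-\lambda(\gamma_i^\vee)\gamma_i$ of $\mathfrak h^*$, with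 length function $l$ with respect to these generators. Put $w\circ\lambda=w(\lambda+\rho)-\rho$, where $\rho=\frac12\sum_{a<b}(\bar e_a-\bar e_b)+m\,c^*$. Let $P^+(\ell)$ be the set of $\lambda\in\mathfrak h^*$ with $\lambda(c)=\ell$ and $\lambda(\gamma_i^\vee)\in\mathbb Z_{\ge0}$ for $0\le i\le m-1$. For weights $\lambda,\mu$ of level $\ell$ write $\beta_{\lambda,\mu}=(\beta_1,\dots,\beta_m)$ for the (unique) nonnegative integers with $\sum_a\beta_a=N$ and $\bar\lambda-\bar\mu=\sum_a\beta_a\bar e_a$, if they exist, i.e. if $\bar\lambda-\bar\mu$ is a weight of $(\mathbb C^m)^{\otimes N}$. With $(q)_n=(1-q)\cdots(1-q^n)$ put $$\begin{bmatrix}N\\ \beta_{\lambda,\mu}\end{bmatrix}=\frac{(q)_N}{(q)_{\beta_1}\cdots(q)_{\beta_m}},$$ and let this be $0$ if $\beta_{\lambda,\mu}$ does not exist. Let $\lambda,\mu\in P^+(\ell)$ be such that $\beta=\beta_{\lambda,\mu}$ exists. Put $\mu_a=(\mu,\bar e_a)=\mu\bigl(E_{aa}-\tfrac1m\mathbf 1\bigr)$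 and $Y=\{(a,p): 1\le a\le m,\ p=\mu_a+1,\dots,\mu_a+\beta_a\}$. A tableau is a bijection $T:Y\to\{1,\dots,N\}$; it is standard if $T(a,p)<T(a,p+1)$ and $T(a,p)<T(a+1,p)$ whenever both cells lie in $Y$. A standard tableau $T$ is $\ell$-restricted if, for $n=1,\dots,N$, the weight $$\lambda_T^{(n)}=\sum_{a=1}^m\Bigl(\mu_a+\#\{p: (a,p)\in Y,\ T(a,p)\le n\}-\frac nm\Bigr)\bar e_a+\ell c^*$$ belongs to $P^+(\ell)$. Let $T_0$ be the tableau $T_0(a,p)=\sum_{k<a}\beta_k+p-\mu_a$, and $w_T\in S_N$ the permutation with $w_TT_0=T$. Let $\bar R_+=\{\epsilon_i-\epsilon_j: 1\le i<j\le N\}$, let $\bar R_{\beta,+}\subset\bar R_+$ be the set of those $\epsilon_i-\epsilon_j$ for which $i,j$ lie in the same one of the consecutive blocks of $\{1,\dots,N\}$ of sizes $\beta_1,\dots,\beta_m$, and let $\eta_w\in\bigoplus_{i=1}^N\mathbb Z\epsilon_i$ be defined by $(\eta_w,\epsilon_1)=0$ and, for $1\le i<N$, $(\eta_w,\epsilon_i-\epsilon_{i+1})=-1$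 if $\epsilon_i-\epsilon_{i+1}\in w(\bar R_+\setminus\bar R_{\beta,+})$ and $0$ otherwise. Put $d(T)=(\eta_{w_T},\epsilon_1+\dots+\epsilon_N)$ and $$F_{\lambda,\mu}(q)=\sum_{T}q^{d(T)},$$ the sum over all $\ell$-restricted standard tableaux $T$ on $Y$. **Theorem.** The numbers $\lambda(d)-(w\circ\lambda)(d)$, $w\in W_{\mathfrak g}$, are integers, only finitely many $w\in W_{\mathfrak g}$ have $\begin{bmatrix}N\\ \beta_{w\circ\lambda,\mu}\end{bmatrix}\ne0$, and $$F_{\lambda,\mu}(q)=\sum_{w\in W_{\mathfrak g}}(-1)^{l(w)}\,q^{\lambda(d)-(w\circ\lambda)(d)}\begin{bmatrix}N\\ \beta_{w\circ\lambda,\mu}\end{bmatrix}.$$ -/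

import Mathlib

noncomputable section

namespace AffineSl

/-! ### The Cartan subalgebra of the affine Lie algebra of `sl_m` and its dual

Coordinates `1, …, m` of `ℂ^m` are indexed by `Fin m`, i.e. by `0, …, m - 1`. -/

/-- The Cartan subalgebra of `sl_m(ℂ)`: diagonal matrices of trace zero. -/
abbrev FinCartan (m : ℕ) : Type :=
  LinearMap.ker (∑ a, LinearMap.proj a : (Fin m → ℂ) →ₗ[ℂ] ℂ)

/-- The Cartan subalgebra `𝔥 = 𝔥̄ ⊕ ℂ c ⊕ ℂ d` of the affine Lie algebra; the triple `(h, x, y)`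
stands for `h + x c + y d`. -/
abbrev Cartan (m : ℕ) : Type := FinCartan m × ℂ × ℂ

/-- The dual space `𝔥̄^*`. -/
abbrev FinWeight (m : ℕ) : Type := Module.Dual ℂ (FinCartan m)

/-- The dual space `𝔥^*`. -/
abbrev Weight (m : ℕ) : Type := Module.Dual ℂ (Cartan m)

/-- The central element `c`. -/
def cElt (m : ℕ) : Cartan m := (0, 1, 0)

/-- The degree element `d`. -/
def dElt (m : ℕ) : Cartan m := (0, 0, 1)

/-- The fundamental weight `c^*`, with `c^*(c) = 1`, zero on `𝔥̄` and on `d`. -/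
def cStar (m : ℕ) : Weight m := LinearMap.fst ℂ ℂ ℂ ∘ₗ LinearMap.snd ℂ (FinCartan m) (ℂ × ℂ)

/-- The null root `δ`, with `δ(d) = 1`, zero on `𝔥̄` and on `c`. -/
def delta (m : ℕ) : Weight m := LinearMap.snd ℂ ℂ ℂ ∘ₗ LinearMap.snd ℂ (FinCartan m) (ℂ × ℂ)

/-- The weight `ē_a` of the basis vector `u_a` of the vector representation `ℂ^m` of `sl_m`:
the `a`-th diagonal entry. -/
def finE {m : ℕ} (a : Fin m) : FinWeight m := LinearMap.proj a ∘ₗ Submodule.subtype _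

/-- `ē_a` as an element of `𝔥^*` (zero on `c` and `d`). -/
def eBar {m : ℕ} (a : Fin m) : Weight m := finE a ∘ₗ LinearMap.fst ℂ (FinCartan m) (ℂ × ℂ)

/-- The classical part `λ̄` of a weight `λ`: its restriction to `𝔥̄`. -/
def classical {m : ℕ} (lam : Weight m) : FinWeight m :=
  lam ∘ₗ LinearMap.inl ℂ (FinCartan m) (ℂ × ℂ)

/-- The element `E_{aa} - E_{bb}` of `𝔥̄`. -/
def finCoroot {m : ℕ} (a b : Fin m) : FinCartan m :=
  ⟨Pi.single a 1 - Pi.single b 1, by simp [LinearMap.sum_apply]⟩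

/-- The element `E_{aa} - (1/m) · 1` of `𝔥̄`; it corresponds to `ē_a` under the trace form. -/
def finECheck {m : ℕ} (a : Fin m) : FinCartan m :=
  ⟨Pi.single a 1 - fun _ => (m : ℂ)⁻¹, by
    have hm : (m : ℂ) ≠ 0 := by exact_mod_cast a.pos.ne'
    simp [LinearMap.sum_apply, hm]⟩

/-- The coordinate `μ_a = (μ, ē_a)`. -/
def coord {m : ℕ} (mu : Weight m) (a : Fin m) : ℂ := classical mu (finECheck a)

/-- The simple roots `γ_0 = δ - (ē_1 - ē_m)` and `γ_i = ē_i - ē_{i+1}` for `1 ≤ i ≤ m - 1`.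
(With coordinates counted from `0`, `γ_i = ē_{i-1} - ē_i`, where `i - 1` is cyclic.) -/
def simpleRoot {m : ℕ} [NeZero m] (i : Fin m) : Weight m :=
  eBar (i - 1) - eBar i + if i = 0 then delta m else 0

/-- The simple coroots `γ_i^∨`. -/
def simpleCoroot {m : ℕ} [NeZero m] (i : Fin m) : Cartan m :=
  (finCoroot (i - 1) i, 0, 0) + if i = 0 then cElt m else 0

/-- The simple reflections `σ_i(λ) = λ - λ(γ_i^∨) γ_i` of `𝔥^*`. -/
def simpleReflections (m : ℕ) [NeZero m] : Set (Weight m ≃ₗ[ℂ] Weight m) :=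
  {s | ∃ i : Fin m, ∀ lam : Weight m, s lam = lam - lam (simpleCoroot i) • simpleRoot i}

/-- `γ_i(γ_i^∨) = 2`. -/
theorem simpleRoot_simpleCoroot {m : ℕ} [NeZero m] (hm : 2 ≤ m) (i : Fin m) :
    simpleRoot i (simpleCoroot i) = 2 := by
  have h1 : i - 1 ≠ i := by
    obtain ⟨k, rfl⟩ : ∃ k, m = k + 2 := ⟨m - 2, by omega⟩
    intro h
    have h2 : (1 : Fin (k + 2)) = 0 := sub_eq_self.mp h
    simp at h2
  have h2 : (Pi.single i (1 : ℂ) : Fin m → ℂ) (i - 1) = 0 := Pi.single_eq_of_ne h1 _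
  have h3 : (Pi.single (i - 1) (1 : ℂ) : Fin m → ℂ) i = 0 := Pi.single_eq_of_ne h1.symm _
  by_cases h : i = 0
  · rw [simpleRoot, simpleCoroot, if_pos h, if_pos h]
    simp only [eBar, finE, finCoroot, delta, cElt, LinearMap.add_apply, LinearMap.sub_apply,
      LinearMap.comp_apply, LinearMap.fst_apply, LinearMap.snd_apply, Prod.mk_add_mk,
      Submodule.subtype_apply, LinearMap.proj_apply, add_zero, zero_add, Pi.sub_apply,
      Pi.single_eq_same, h2, h3]
    norm_num
  · rw [simpleRoot, simpleCoroot, if_neg h, if_neg h]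
    simp only [eBar, finE, finCoroot, add_zero, LinearMap.sub_apply,
      LinearMap.comp_apply, LinearMap.fst_apply,
      Submodule.subtype_apply, LinearMap.proj_apply, Pi.sub_apply,
      Pi.single_eq_same, h2, h3]
    norm_num

/-- All the simple reflections exist, as linear automorphisms. -/
theorem exists_simpleReflection {m : ℕ} [NeZero m] (hm : 2 ≤ m) (i : Fin m) :
    ∃ s ∈ simpleReflections m,
      ∀ lam : Weight m, s lam = lam - lam (simpleCoroot i) • simpleRoot i := by
  have h : Module.Dual.eval ℂ (Cartan m) (simpleCoroot i) (simpleRoot i) = 2 :=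
    simpleRoot_simpleCoroot hm i
  refine ⟨Module.reflection h, ⟨i, fun lam => ?_⟩, fun lam => ?_⟩ <;>
    simp [Module.reflection_apply]

/-- The Weyl group of the affine Lie algebra: the group of automorphisms of `𝔥^*` generated by
the simple reflections. -/
def weylGroup (m : ℕ) [NeZero m] : Subgroup (Weight m ≃ₗ[ℂ] Weight m) :=
  Subgroup.closure (simpleReflections m)

/-- The length `l(w)`: the least number of factors in an expression of `w` as a product of simple
reflections. -/
def length {m : ℕ} [NeZero m] (w : weylGroup m) : ℕ :=
  sInf {n | ∃ L : List (Weight m ≃ₗ[ℂ] Weight m),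
    L.length = n ∧ (∀ s ∈ L, s ∈ simpleReflections m) ∧ L.prod = (w : Weight m ≃ₗ[ℂ] Weight m)}

/-- `ρ = ρ̄ + m c^*`, where `ρ̄` is half the sum of the positive roots `ē_a - ē_b`, `a < b`. -/
def rho (m : ℕ) : Weight m :=
  (2⁻¹ : ℂ) • (∑ p : Fin m × Fin m, if p.1 < p.2 then eBar p.1 - eBar p.2 else 0) +
    (m : ℂ) • cStar m

/-- The dot action `w ∘ λ = w(λ + ρ) - ρ`. -/
def dot {m : ℕ} [NeZero m] (w : weylGroup m) (lam : Weight m) : Weight m :=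
  (w : Weight m ≃ₗ[ℂ] Weight m) (lam + rho m) - rho m

/-- The set `P^+(ℓ)` of dominant integral weights of level `ℓ`. -/
def dominantIntegral (m : ℕ) [NeZero m] (l : ℂ) : Set (Weight m) :=
  {lam | lam (cElt m) = l ∧ ∀ i : Fin m, ∃ k : ℕ, lam (simpleCoroot i) = k}

/-! ### Compositions and `q`-multinomial coefficients -/

/-- `β = β_{λ,μ}`: `β_1, …, β_m` are nonnegative integers of sum `N` such that
`λ̄ - μ̄ = ∑ β_a ē_a`. Such a `β` exists if and only if `λ̄ - μ̄` is a weight of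
`(ℂ^m)^{⊗ N}`, and it is then unique. -/
def IsComposition {m : ℕ} (N : ℕ) (lam mu : Weight m) (beta : Fin m → ℕ) : Prop :=
  ∑ a, beta a = N ∧ classical lam - classical mu = ∑ a, (beta a : ℂ) • finE a

/-- `(q)_n = (1 - q) (1 - q^2) ⋯ (1 - q^n)` in `ℚ(q)`. -/
def qPoch (n : ℕ) : RatFunc ℚ := ∏ i ∈ Finset.range n, (1 - RatFunc.X ^ (i + 1))

open Classical in
/-- The `q`-multinomial coefficient `[N; β_{λ,μ}]`; it is zero if `λ̄ - μ̄` is not a weight of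
`(ℂ^m)^{⊗ N}`. -/
def qMultinomial {m : ℕ} (N : ℕ) (lam mu : Weight m) : RatFunc ℚ :=
  if h : ∃ beta, IsComposition N lam mu beta then
    qPoch N / ∏ a, qPoch (h.choose a)
  else 0

/-! ### Tableaux

Numbers `1, …, N` are indexed by `Fin N`, i.e. by `0, …, N - 1`. -/

/-- The cells of the diagram: the pair `(a, k)` with `0 ≤ k < β_a` stands for the cell `(a, p)`
with `p = μ_a + k + 1`. -/
abbrev Cell {m : ℕ} (beta : Fin m → ℕ) : Type := Σ a : Fin m, Fin (beta a)

/-- The second coordinate `p = μ_a + k + 1` of a cell. -/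
def Cell.col {m : ℕ} (mu : Weight m) {beta : Fin m → ℕ} (x : Cell beta) : ℂ :=
  coord mu x.1 + ((x.2 : ℕ) : ℂ) + 1

/-- Tableaux: bijections from the diagram onto `{1, …, N}`, where `N = ∑ β_a`. -/
abbrev Tableau {m : ℕ} (beta : Fin m → ℕ) : Type := Cell beta ≃ Fin (∑ a, beta a)

/-- Standard tableaux: `T(a, p) < T(a, p + 1)` and `T(a, p) < T(a + 1, p)` whenever both cells
belong to the diagram. -/
def IsStandard {m : ℕ} (mu : Weight m) {beta : Fin m → ℕ} (T : Tableau beta) : Prop :=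
  (∀ x y : Cell beta, y.1 = x.1 → y.col mu = x.col mu + 1 → T x < T y) ∧
  (∀ x y : Cell beta, (y.1 : ℕ) = x.1 + 1 → y.col mu = x.col mu → T x < T y)

/-- `β_{T,a}^{(n)}`: the number of cells of row `a` with an entry at most `n`. -/
def rowCount {m : ℕ} {beta : Fin m → ℕ} (T : Tableau beta) (n : ℕ) (a : Fin m) : ℕ :=
  Nat.card {k : Fin (beta a) // (T ⟨a, k⟩ : ℕ) + 1 ≤ n}

/-- `λ_T^{(n)} = ∑_a (μ_a + β_{T,a}^{(n)} - n/m) ē_a + ℓ c^*`. -/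
def tableauWeight {m : ℕ} (l : ℂ) (mu : Weight m) {beta : Fin m → ℕ} (T : Tableau beta) (n : ℕ) :
    Weight m :=
  ∑ a, (coord mu a + rowCount T n a - (n : ℂ) / m) • eBar a + l • cStar m

/-- `ℓ`-restricted standard tableaux. -/
def restrictedTableaux {m : ℕ} [NeZero m] (l : ℂ) (mu : Weight m) (beta : Fin m → ℕ) :
    Set (Tableau beta) :=
  {T | IsStandard mu T ∧
    ∀ n : ℕ, 1 ≤ n → n ≤ ∑ a, beta a → tableauWeight l mu T n ∈ dominantIntegral m l}

/-- The tableau `T_0(a, p) = ∑_{k < a} β_k + p - μ_a`, the row reading of the diagram. -/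
def baseTableau {m : ℕ} (beta : Fin m → ℕ) : Tableau beta := finSigmaFinEquiv

/-- The permutation `w_T` of `{1, …, N}` with `w_T T_0 = T`. -/
def tableauPerm {m : ℕ} {beta : Fin m → ℕ} (T : Tableau beta) :
    Equiv.Perm (Fin (∑ a, beta a)) :=
  (baseTableau beta).symm.trans T

/-- The roots in `R̄_+ ∖ R̄_{β,+}`; the pair `(i, j)` stands for `ε_i - ε_j`. It is a positive root
if `i < j`, and a root of `R̄_β` if `i` and `j` belong to the same one of the consecutive blocks of
sizes `β_1, …, β_m`. -/
def outerPosRoots {m : ℕ} (beta : Fin m → ℕ) :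
    Set (Fin (∑ a, beta a) × Fin (∑ a, beta a)) :=
  {r | r.1 < r.2 ∧ ((baseTableau beta).symm r.1).1 ≠ ((baseTableau beta).symm r.2).1}

/-- The simple root `α_i = ε_i - ε_{i+1}` of `gl_N` belongs to `w(R̄_+ ∖ R̄_{β,+})`
(here `i` counts from `0`). -/
def SimpleRootMem {m : ℕ} {beta : Fin m → ℕ} (w : Equiv.Perm (Fin (∑ a, beta a))) (i : ℕ) : Prop :=
  ∃ h : i + 1 < ∑ a, beta a,
    ((⟨i, by omega⟩, ⟨i + 1, h⟩) : Fin (∑ a, beta a) × Fin (∑ a, beta a)) ∈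
      Prod.map w w '' outerPosRoots beta

open Classical in
/-- The pairings `(η_w, α_i)`. -/
def etaPairing {m : ℕ} {beta : Fin m → ℕ} (w : Equiv.Perm (Fin (∑ a, beta a))) (i : ℕ) : ℤ :=
  if SimpleRootMem w i then -1 else 0

/-- The coordinates `(η_w, ε_1), (η_w, ε_2), …` of `η_w`: the first one is zero, and
`(η_w, ε_i) - (η_w, ε_{i+1})` is the pairing with `α_i`. -/
def eta {m : ℕ} {beta : Fin m → ℕ} (w : Equiv.Perm (Fin (∑ a, beta a))) : ℕ → ℤ
  | 0 => 0
  | i + 1 => eta w i - etaPairing w i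

/-- `d(T) = η_{w_T}(ε_1 + ⋯ + ε_N)`. -/
def dStat {m : ℕ} {beta : Fin m → ℕ} (T : Tableau beta) : ℤ :=
  ∑ i ∈ Finset.range (∑ a, beta a), eta (tableauPerm T) i

/-- `F_{λ,μ}(q) = ∑_T q^{d(T)}`, the sum over all `ℓ`-restricted standard tableaux; it depends on
`λ` only through `β = β_{λ,μ}`. The set of tableaux is finite. -/
def generatingFunction {m : ℕ} [NeZero m] (l : ℂ) (mu : Weight m) (beta : Fin m → ℕ) :
    RatFunc ℚ :=
  ∑ᶠ T ∈ restrictedTableaux l mu beta, (RatFunc.X : RatFunc ℚ) ^ dStat T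

end AffineSl

end

/-! Recording the row of each entry `1, …, N` turns a tableau into a word in the letters `1, …, m`.
Shifted by `ρ`, the `ℓ`-restricted standard tableaux become the lattice paths from `μ + ρ` to `λ +
ρ` modulo `δ` with steps `ē_b` that stay strictly dominant (`bijOn_rowWord`), and `d(T)` becomes a
sum over ascents of the word, each weighted by the number of letters from its upper letter to the
end (`dStat_eq_energy`). The theorem is then a reflection principle with a `q`-weight.

Whether the next step is an ascent depends on the previous letter, so both sides are refined by a
letter `a` placed before the word. Without walls, the generating function of words of content `β` is
the multinomial times `q ^ ∑_{c > a} β_c`, and removing the first letter gives a recursion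
(`refinedMultinomial_succ`). The signed sum of these functions over the orbit of `λ + ρ` inherits
the recursion (`alternatingSum_succ`). It equals the count of dominant paths for three reasons.

A step `ē_b` out of the chamber lands on the wall of the coroot with index `b`, counted from `0`
(`exists_simpleCoroot_eq_zero`). On that wall, with that same letter in front, the terms of `w` and
`σ_b w` cancel (`alternatingSum_eq_zero`): the refined multinomial is symmetric under `σ_b`, up to a
power of `q` for `b = 0` that is exactly the change in the value at `d`
(`refinedMultinomial_reflection`). So steps out of the chamber contribute nothing. With no steps
left, only `w = 1` contributes, since no other `w` carries a strictly dominant weight to the class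
modulo `δ` of one of the same level (`eq_one_of_isStrictlyDominant`).

Finally, the largest letter in front creates no ascent, so the refinement disappears. -/

noncomputable section
namespace AffineSl

/-! ### Coordinates of weights -/

section Coordinates

variable {m : ℕ}

theorem classical_add (x y : Weight m) : classical (x + y) = classical x + classical y := rfl

theorem classical_sub (x y : Weight m) : classical (x - y) = classical x - classical y := rfl

theorem classical_eBar (a : Fin m) : classical (eBar a) = finE a := by
  ext h; simp [classical, eBar]

theorem classical_smul (c : ℂ) (x : Weight m) : classical (c • x) = c • classical x := rfl

theorem classical_delta : classical (delta m) = 0 := by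
  ext h; simp [classical, delta]

theorem classical_cStar : classical (cStar m) = 0 := by
  ext h; simp [classical, cStar]

theorem classical_sum {ι : Type*} (s : Finset ι) (f : ι → Weight m) :
    classical (∑ i ∈ s, f i) = ∑ i ∈ s, classical (f i) := by
  ext h; simp [classical, LinearMap.sum_apply]

/-- The pairing of a finite weight with `E_{aa} - (1/m) 1`. -/
def finCoord (D : FinWeight m) (a : Fin m) : ℂ := D (finECheck a)

theorem finCoord_sum (c : Fin m → ℂ) (a : Fin m) :
    finCoord (∑ b, c b • finE b) a = c a - (∑ b, c b) / m := by
  simp [finCoord, LinearMap.sum_apply, finE, finECheck, mul_sub, Finset.sum_sub_distrib,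
    Pi.single_apply, ← Finset.sum_mul, div_eq_mul_inv]

theorem sum_finCartan (h : FinCartan m) : ∑ a, (h : Fin m → ℂ) a = 0 := by
  have := LinearMap.mem_ker.mp h.2
  simpa only [LinearMap.sum_apply, LinearMap.proj_apply] using this

theorem finCartan_eq_sum (h : FinCartan m) : h = ∑ a, (h : Fin m → ℂ) a • finECheck a := by
  ext b
  simp [finECheck, mul_sub, Finset.sum_sub_distrib, Pi.single_apply, ← Finset.sum_mul, sum_finCartan h]

theorem finWeight_eq_sum (D : FinWeight m) : D = ∑ a, finCoord D a • finE a := by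
  ext h
  conv_lhs => rw [finCartan_eq_sum h, map_sum]
  simp [LinearMap.sum_apply, finE, finCoord, mul_comm]

theorem sum_finE [NeZero m] : ∑ a : Fin m, finE a = 0 := by
  ext h
  simpa [LinearMap.sum_apply, finE] using sum_finCartan h

theorem sum_finCoord [NeZero m] (D : FinWeight m) : ∑ a, finCoord D a = 0 := by
  have h : ∑ a : Fin m, finECheck a = 0 := by
    ext b
    have hm : (m : ℂ) ≠ 0 := by exact_mod_cast NeZero.ne m
    simp [finECheck, Finset.sum_sub_distrib, Pi.single_apply, hm]
  simp only [finCoord, ← map_sum, h, map_zero]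

theorem finCoroot_eq (a b : Fin m) : finCoroot a b = finECheck a - finECheck b := by
  ext; simp [finCoroot, finECheck]

theorem ext_finCoord {D D' : FinWeight m} (h : ∀ a, finCoord D a = finCoord D' a) : D = D' := by
  rw [finWeight_eq_sum D, finWeight_eq_sum D']; simp [h]

theorem weight_apply (x : Weight m) (h : FinCartan m) (y z : ℂ) :
    x (h, y, z) = classical x h + y * x (cElt m) + z * x (dElt m) := by
  have : (h, y, z) = (h, (0 : ℂ), (0 : ℂ)) + y • cElt m + z • dElt m := by simp [cElt, dElt]
  rw [this, map_add, map_add, map_smul, map_smul]; rfl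

theorem ext_weight {x y : Weight m} (h : classical x = classical y)
    (hc : x (cElt m) = y (cElt m)) (hd : x (dElt m) = y (dElt m)) : x = y := by
  refine LinearMap.ext fun ⟨a, b, c⟩ => ?_
  rw [weight_apply x, weight_apply y, h, hc, hd]

@[simp] theorem eBar_cElt (a : Fin m) : eBar a (cElt m) = 0 := by simp [eBar, cElt]

@[simp] theorem eBar_dElt (a : Fin m) : eBar a (dElt m) = 0 := by simp [eBar, dElt]

@[simp] theorem delta_cElt : delta m (cElt m) = 0 := by simp [delta, cElt]

@[simp] theorem delta_dElt : delta m (dElt m) = 1 := by simp [delta, dElt]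

@[simp] theorem cStar_cElt : cStar m (cElt m) = 1 := by simp [cStar, cElt]

@[simp] theorem cStar_dElt : cStar m (dElt m) = 0 := by simp [cStar, dElt]

theorem rho_dElt : rho m (dElt m) = 0 := by
  simp only [rho, LinearMap.add_apply, LinearMap.smul_apply, LinearMap.sum_apply, cStar_dElt]
  rw [Finset.sum_eq_zero]
  · simp
  · intro p _; split_ifs <;> simp

theorem rho_cElt : rho m (cElt m) = m := by
  simp only [rho, LinearMap.add_apply, LinearMap.smul_apply, LinearMap.sum_apply, cStar_cElt]
  rw [Finset.sum_eq_zero]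
  · simp
  · intro p _; split_ifs <;> simp

variable [NeZero m]

theorem pred_ne_self (hm : 2 ≤ m) (i : Fin m) : i - 1 ≠ i := by
  obtain ⟨k, rfl⟩ : ∃ k, m = k + 2 := ⟨m - 2, by omega⟩
  intro h
  have h2 : (1 : Fin (k + 2)) = 0 := sub_eq_self.mp h
  simp at h2

theorem apply_simpleCoroot (x : Weight m) (i : Fin m) :
    x (simpleCoroot i) =
      classical x (finCoroot (i - 1) i) + if i = 0 then x (cElt m) else 0 := by
  split_ifs with h
  · rw [simpleCoroot, if_pos h, map_add]; rfl
  · rw [simpleCoroot, if_neg h, add_zero, add_zero]; rfl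

theorem apply_simpleCoroot' (x : Weight m) (i : Fin m) :
    x (simpleCoroot i) = finCoord (classical x) (i - 1) - finCoord (classical x) i +
      if i = 0 then x (cElt m) else 0 := by
  rw [apply_simpleCoroot, finCoroot_eq, map_sub]; rfl

theorem eBar_simpleCoroot (a i : Fin m) :
    eBar a (simpleCoroot i) = (if a = i - 1 then 1 else 0) - if a = i then 1 else 0 := by
  rw [apply_simpleCoroot, classical_eBar]
  simp [finE, finCoroot, Pi.single_apply]

theorem classical_simpleRoot (i : Fin m) :
    classical (simpleRoot i) = finE (i - 1) - finE i := by
  rw [simpleRoot, classical_add, classical_sub, classical_eBar, classical_eBar]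
  split_ifs
  · rw [classical_delta, add_zero]
  · exact add_zero _

theorem simpleRoot_cElt (i : Fin m) : simpleRoot i (cElt m) = 0 := by
  simp only [simpleRoot]; split_ifs <;> simp

theorem simpleRoot_dElt (i : Fin m) : simpleRoot i (dElt m) = if i = 0 then 1 else 0 := by
  simp only [simpleRoot]; split_ifs <;> simp

theorem finCoord_simpleRoot (i a : Fin m) : finCoord (classical (simpleRoot i)) a =
    (if a = i - 1 then 1 else 0) - if a = i then 1 else 0 := by
  have h : classical (simpleRoot i) = ∑ b,
      (((if b = i - 1 then 1 else 0) - if b = i then 1 else 0 : ℂ)) • finE b := by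
    simp [classical_simpleRoot, sub_smul, Finset.sum_sub_distrib]
  rw [h, finCoord_sum]; simp [Finset.sum_sub_distrib]

/-- `ρ` takes the value one on all simple coroots. -/
theorem rho_simpleCoroot (hm : 2 ≤ m) (i : Fin m) : rho m (simpleCoroot i) = 1 := by
  -- In the sum over pairs, coordinate `a` occurs `m - 1 - a` times with a plus sign and `a` times
  -- with a minus sign.
  have key : ∀ h : FinCartan m, classical (rho m) h =
      2⁻¹ * ∑ a : Fin m, ((m : ℂ) - 1 - 2 * (a : ℕ)) * (h : Fin m → ℂ) a := by
    intro h
    have h1 : ∀ a : Fin m, ∑ b : Fin m, (if a < b then (h : Fin m → ℂ) a else 0) =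
        ((m : ℂ) - 1 - (a : ℕ)) * (h : Fin m → ℂ) a := by
      intro a
      rw [← Finset.sum_filter, Finset.sum_const]
      have : ({b | a < b} : Finset (Fin m)) = Finset.Ioi a := by ext; simp
      rw [this, Fin.card_Ioi, nsmul_eq_mul, Nat.cast_sub (by omega), Nat.cast_sub (by omega)]
      simp
    have h2 : ∀ b : Fin m, ∑ a : Fin m, (if a < b then (h : Fin m → ℂ) b else 0) =
        (b : ℕ) * (h : Fin m → ℂ) b := by
      intro b
      rw [← Finset.sum_filter, Finset.sum_const]
      have : ({a | a < b} : Finset (Fin m)) = Finset.Iio b := by ext; simp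
      rw [this, Fin.card_Iio, nsmul_eq_mul]
    have h3 : classical (rho m) h = 2⁻¹ * ∑ p : Fin m × Fin m,
        ((if p.1 < p.2 then (h : Fin m → ℂ) p.1 else 0) -
          if p.1 < p.2 then (h : Fin m → ℂ) p.2 else 0) := by
      rw [rho, classical_add, classical_smul, classical_smul, classical_cStar, classical_sum]
      simp only [LinearMap.add_apply, LinearMap.smul_apply, LinearMap.sum_apply, smul_eq_mul,
        LinearMap.zero_apply, mul_zero, add_zero]
      congr 1
      refine Finset.sum_congr rfl fun p _ => ?_
      split_ifs
      · rw [classical_sub, classical_eBar, classical_eBar]; rfl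
      · simp [classical]
    rw [h3, Finset.sum_sub_distrib, Fintype.sum_prod_type, Fintype.sum_prod_type_right]
    simp_rw [h1, h2]
    rw [← Finset.sum_sub_distrib]
    congr 1
    exact Finset.sum_congr rfl fun a _ => by ring
  rw [apply_simpleCoroot, key, rho_cElt]
  have h4 : ∑ a : Fin m, ((m : ℂ) - 1 - 2 * (a : ℕ)) * (finCoroot (i - 1) i : Fin m → ℂ) a =
      2 * (i : ℕ) - 2 * ((i - 1 : Fin m) : ℕ) := by
    simp only [finCoroot, Pi.sub_apply, mul_sub, Finset.sum_sub_distrib, Pi.single_apply,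
      mul_ite, mul_one, mul_zero, Finset.sum_ite_eq', Finset.mem_univ, if_true]
    ring
  rw [h4]
  -- For `i = 0` the classical part contributes `1 - m`, and the level `m` of `ρ` brings the value
  -- to one.
  split_ifs with hi
  · subst hi
    have : (((0 - 1 : Fin m)) : ℕ) = m - 1 := by
      obtain ⟨k, rfl⟩ : ∃ k, m = k + 2 := ⟨m - 2, by omega⟩
      simp [Fin.coe_neg_one]
    rw [this, Nat.cast_sub (by omega)]
    simp
  · have : (((i - 1 : Fin m)) : ℕ) = i - 1 := by
      obtain ⟨k, rfl⟩ : ∃ k, m = k + 2 := ⟨m - 2, by omega⟩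
      rw [Fin.val_sub_one_of_ne_zero hi]
    have hpos : 1 ≤ (i : ℕ) := by
      exact Nat.one_le_iff_ne_zero.mpr fun h => hi (Fin.ext h)
    rw [this, Nat.cast_sub hpos]
    simp; ring

end Coordinates

/-! ### The Weyl group -/

section WeylGroup

variable {m : ℕ}

theorem sum_smul_finE_swap (b : Fin m → ℂ) (i j : Fin m) :
    ∑ a, b (Equiv.swap i j a) • finE a =
      ∑ a, b a • finE a - (b i - b j) • (finE i - finE j) := by
  rcases eq_or_ne i j with rfl | hij
  · simp
  have h : ∀ a, b (Equiv.swap i j a) =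
      b a - (b i - b j) * ((if a = i then 1 else 0) - if a = j then 1 else 0) := by
    intro a
    rcases eq_or_ne a i with rfl | hi
    · simp [hij]
    rcases eq_or_ne a j with rfl | hj
    · simp [hij.symm]
    rw [Equiv.swap_apply_of_ne_of_ne hi hj]; simp [hi, hj]
  simp_rw [h, sub_smul, mul_sub, Finset.sum_sub_distrib, sub_smul, Finset.sum_sub_distrib]
  simp [smul_sub, sub_smul]
  abel

variable [NeZero m]

/-- Integral weights: those with integral values on the simple coroots. -/
def IsIntegral (x : Weight m) : Prop := ∀ i : Fin m, ∃ k : ℤ, x (simpleCoroot i) = k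

/-- Strictly dominant weights: those with positive integral values on the simple coroots. -/
def IsStrictlyDominant (x : Weight m) : Prop :=
  ∀ i : Fin m, ∃ k : ℕ, x (simpleCoroot i) = k + 1

theorem IsStrictlyDominant.isIntegral {x : Weight m} (h : IsStrictlyDominant x) :
    IsIntegral x := fun i => by
  obtain ⟨k, hk⟩ := h i
  exact ⟨k + 1, by rw [hk]; push_cast; rfl⟩

theorem simpleReflection_mem_weylGroup {s : Weight m ≃ₗ[ℂ] Weight m}
    (hs : s ∈ simpleReflections m) : s ∈ weylGroup m := Subgroup.subset_closure hs

theorem simpleReflection_mul_self (hm : 2 ≤ m) {s : Weight m ≃ₗ[ℂ] Weight m}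
    (hs : s ∈ simpleReflections m) : s * s = 1 := by
  obtain ⟨i, hi⟩ := hs
  ext1 x
  change s (s x) = x
  rw [hi x, map_sub, map_smul, hi, hi (simpleRoot i), simpleRoot_simpleCoroot hm]
  module

/-- Every element of the Weyl group is a product of simple reflections. -/
theorem exists_list_prod_eq (hm : 2 ≤ m) {w : Weight m ≃ₗ[ℂ] Weight m} (hw : w ∈ weylGroup m) :
    ∃ L : List (Weight m ≃ₗ[ℂ] Weight m), (∀ s ∈ L, s ∈ simpleReflections m) ∧ L.prod = w := by
  rw [weylGroup, ← Subgroup.mem_toSubmonoid, Subgroup.closure_toSubmonoid] at hw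
  obtain ⟨L, hL, h⟩ := Submonoid.exists_list_of_mem_closure hw
  refine ⟨L, fun s hs => ?_, h⟩
  rcases hL s hs with h | h
  · exact h
  · have := simpleReflection_mul_self hm (Set.mem_inv.mp h)
    rw [mul_eq_one_iff_eq_inv, inv_inv] at this
    rwa [← this]

/-- Induction on the Weyl group by left multiplication with simple reflections. -/
theorem weylGroup_induction (hm : 2 ≤ m) {p : (Weight m ≃ₗ[ℂ] Weight m) → Prop} (one : p 1)
    (mul : ∀ s ∈ simpleReflections m, ∀ w, p w → p (s * w))
    {w : Weight m ≃ₗ[ℂ] Weight m} (hw : w ∈ weylGroup m) : p w := by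
  obtain ⟨L, hL, rfl⟩ := exists_list_prod_eq hm hw
  clear hw
  induction L with
  | nil => exact one
  | cons s L ih =>
    rw [List.prod_cons]
    have hL' : ∀ t ∈ L, t ∈ simpleReflections m := fun t ht => hL t (List.mem_cons_of_mem _ ht)
    exact mul s (hL s List.mem_cons_self) _
      (ih hL')

/-! ### Determinants and signs -/

theorem det_simpleReflection (hm : 2 ≤ m) {s : Weight m ≃ₗ[ℂ] Weight m}
    (hs : s ∈ simpleReflections m) : LinearEquiv.det s = -1 := by
  obtain ⟨i, hi⟩ := hs
  ext
  rw [LinearEquiv.coe_det]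
  have : (s : Weight m →ₗ[ℂ] Weight m) =
      LinearMap.transvection (Module.Dual.eval ℂ (Cartan m) (simpleCoroot i)) (-simpleRoot i) := by
    ext1 x
    rw [LinearMap.transvection.apply, LinearEquiv.coe_coe, hi]
    simp [sub_eq_add_neg]
  rw [this, LinearMap.transvection.det]
  simp [simpleRoot_simpleCoroot hm]
  norm_num

/-- The sign of an element of the Weyl group. -/
def sign (w : weylGroup m) : ℤ := (-1) ^ length w

/-- Each factor of a shortest word has determinant `-1`. The determinant is multiplicative, which
the length is not, so it controls the sign of `s * w`. -/
theorem sign_eq_det (hm : 2 ≤ m) (w : weylGroup m) :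
    ((sign w : ℤ) : ℂ) = LinearEquiv.det (w : Weight m ≃ₗ[ℂ] Weight m) := by
  have hne : {n | ∃ L : List (Weight m ≃ₗ[ℂ] Weight m),
      L.length = n ∧ (∀ s ∈ L, s ∈ simpleReflections m) ∧
        L.prod = (w : Weight m ≃ₗ[ℂ] Weight m)}.Nonempty := by
    obtain ⟨L, hL, h⟩ := exists_list_prod_eq hm w.2
    exact ⟨L.length, L, rfl, hL, h⟩
  obtain ⟨L, hl, hL, h⟩ := Nat.sInf_mem hne
  rw [sign, length, ← hl, ← h]
  clear hl h hne
  induction L with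
  | nil => simp
  | cons s L ih =>
    have hL' : ∀ t ∈ L, t ∈ simpleReflections m := fun t ht => hL t (List.mem_cons_of_mem _ ht)
    rw [List.prod_cons, map_mul, det_simpleReflection hm (hL s List.mem_cons_self),
      Units.val_mul, ← ih hL', List.length_cons, pow_succ']
    push_cast; rfl

theorem sign_one (hm : 2 ≤ m) : sign (1 : weylGroup m) = 1 := by
  have := sign_eq_det hm (1 : weylGroup m)
  rw [OneMemClass.coe_one, map_one, Units.val_one] at this
  exact_mod_cast this

theorem sign_mul (hm : 2 ≤ m) {s : weylGroup m}
    (hs : (s : Weight m ≃ₗ[ℂ] Weight m) ∈ simpleReflections m) (w : weylGroup m) :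
    sign (s * w) = -sign w := by
  have h := sign_eq_det hm (s * w)
  rw [Subgroup.coe_mul, map_mul, det_simpleReflection hm hs, Units.val_mul,
    ← sign_eq_det hm w] at h
  have h' : ((sign (s * w) : ℤ) : ℂ) = ((-sign w : ℤ) : ℂ) := by rw [h]; simp
  exact_mod_cast h'

theorem weylGroup_cElt (hm : 2 ≤ m) {w : Weight m ≃ₗ[ℂ] Weight m} (hw : w ∈ weylGroup m)
    (x : Weight m) : w x (cElt m) = x (cElt m) := by
  refine weylGroup_induction hm (p := fun w => w x (cElt m) = x (cElt m)) rfl ?_ hw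
  rintro s ⟨i, hi⟩ w ih
  change s (w x) (cElt m) = _
  rw [hi, LinearMap.sub_apply, LinearMap.smul_apply, simpleRoot_cElt, smul_zero, sub_zero, ih]

theorem simpleRoot_isIntegral (i : Fin m) : IsIntegral (simpleRoot i) := by
  intro j
  rw [apply_simpleCoroot', simpleRoot_cElt, finCoord_simpleRoot, finCoord_simpleRoot]
  refine ⟨((if j - 1 = i - 1 then 1 else 0) - if j - 1 = i then 1 else 0) -
    ((if j = i - 1 then 1 else 0) - if j = i then 1 else 0), ?_⟩
  push_cast
  simp

/-- One induction serves both claims: a further reflection changes the value at `d` by zero or by a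
coroot value of `w x`. -/
theorem weylGroup_integral (hm : 2 ≤ m) {w : Weight m ≃ₗ[ℂ] Weight m} (hw : w ∈ weylGroup m)
    {x : Weight m} (hx : IsIntegral x) :
    IsIntegral (w x) ∧ ∃ k : ℤ, (k : ℂ) = x (dElt m) - w x (dElt m) := by
  refine weylGroup_induction hm (p := fun w => IsIntegral (w x) ∧
    ∃ k : ℤ, (k : ℂ) = x (dElt m) - w x (dElt m)) ⟨hx, 0, by simp⟩ ?_ hw
  rintro s ⟨i, hi⟩ w ⟨h, k, hk⟩
  change IsIntegral (s (w x)) ∧ ∃ k : ℤ, (k : ℂ) = x (dElt m) - s (w x) (dElt m)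
  rw [hi]
  obtain ⟨n, hn⟩ := h i
  refine ⟨fun j => ?_, k + n * (if i = 0 then 1 else 0), ?_⟩
  · obtain ⟨p, hp⟩ := h j
    obtain ⟨q, hq⟩ := simpleRoot_isIntegral i j
    refine ⟨p - n * q, ?_⟩
    rw [LinearMap.sub_apply, LinearMap.smul_apply, hp, hn, hq]
    push_cast; rfl
  · rw [LinearMap.sub_apply, LinearMap.smul_apply, simpleRoot_dElt, hn]
    push_cast
    rw [hk, smul_eq_mul]; ring

/-! ### The action on periodic sequences -/

/-- The residue class of an integer. -/
def residue (m : ℕ) [NeZero m] (k : ℤ) : Fin m := Fin.ofNat m (k % m).toNat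

/-- The sequence of coordinates of a weight, extended to all integers quasi-periodically. -/
def coordSeq (x : Weight m) (k : ℤ) : ℂ :=
  finCoord (classical x) (residue m k) - (k / m : ℤ) * x (cElt m)

theorem residue_val (k : ℤ) : ((residue m k : ℕ) : ℤ) = k % m := by
  have hm : (0 : ℤ) < m := by exact_mod_cast NeZero.pos m
  have h1 := Int.emod_nonneg k hm.ne'
  have h2 := Int.emod_lt_of_pos k hm
  have h3 : (k % m).toNat < m := by omega
  simp [residue, Fin.ofNat, Nat.mod_eq_of_lt h3, h1]

theorem residue_eq_iff {k : ℤ} {a : Fin m} : residue m k = a ↔ k % m = (a : ℕ) := by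
  rw [← residue_val, Fin.ext_iff]; norm_cast

theorem residue_coe (a : Fin m) : residue m ((a : ℕ) : ℤ) = a := by
  rw [residue_eq_iff]
  exact Int.emod_eq_of_lt (by positivity) (by exact_mod_cast a.2)

theorem coordSeq_coe (x : Weight m) (a : Fin m) :
    coordSeq x ((a : ℕ) : ℤ) = finCoord (classical x) a := by
  have : ((a : ℕ) : ℤ) / (m : ℤ) = 0 :=
    Int.ediv_eq_zero_of_lt (by positivity) (by exact_mod_cast a.2)
  rw [coordSeq, this, residue_coe]; simp

theorem sub_one_residue (hm : 2 ≤ m) (k : ℤ) :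
    residue m (k - 1) = residue m k - 1 ∧
      (k - 1) / (m : ℤ) = k / m - if residue m k = 0 then 1 else 0 := by
  have hmpos : (0 : ℤ) < m := by exact_mod_cast NeZero.pos m
  have h1 := Int.emod_nonneg k hmpos.ne'
  have h2 := Int.emod_lt_of_pos k hmpos
  have h3 := Int.mul_ediv_add_emod k m
  have hval := residue_val (m := m) k
  obtain ⟨n, rfl⟩ : ∃ n, m = n + 2 := ⟨m - 2, by omega⟩
  by_cases h0 : residue (n + 2) k = 0
  · rw [h0] at hval ⊢
    simp only [Fin.val_zero, Nat.cast_zero] at hval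
    have hk : k - 1 = (n + 1 : ℤ) + ((n + 2 : ℕ) : ℤ) * (k / ((n + 2 : ℕ) : ℤ) - 1) := by
      push_cast at *; linarith
    have hlt : (n + 1 : ℤ) < ((n + 2 : ℕ) : ℤ) := by push_cast; linarith
    constructor
    · rw [residue_eq_iff, hk, Int.add_mul_emod_self_left,
        Int.emod_eq_of_lt (by positivity) hlt]
      simp [Fin.coe_neg_one]
    · conv_lhs => rw [hk]
      rw [Int.add_mul_ediv_left _ _ hmpos.ne', Int.ediv_eq_zero_of_lt (by positivity) hlt]
      simp
  · have hne : k % ((n + 2 : ℕ) : ℤ) ≠ 0 := by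
      intro h; apply h0; rw [residue_eq_iff, h]; simp
    have hk : k - 1 = (k % ((n + 2 : ℕ) : ℤ) - 1) +
        ((n + 2 : ℕ) : ℤ) * (k / ((n + 2 : ℕ) : ℤ)) := by linarith
    constructor
    · rw [residue_eq_iff, hk, Int.add_mul_emod_self_left,
        Int.emod_eq_of_lt (by omega) (by omega), Fin.val_sub_one_of_ne_zero h0]
      have : 1 ≤ ((residue (n + 2) k : Fin (n + 2)) : ℕ) := by omega
      push_cast [Nat.cast_sub this]; rw [hval]; push_cast; rfl
    · conv_lhs => rw [hk]
      rw [Int.add_mul_ediv_left _ _ hmpos.ne', Int.ediv_eq_zero_of_lt (by omega) (by omega),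
        if_neg h0]
      simp

/-- The term `(k / m) * x(c)` in `coordSeq` supplies the level in `γ_0^∨` whenever a multiple of `m`
is crossed, so one formula covers the finite and the affine coroots. -/
theorem coordSeq_sub_one (hm : 2 ≤ m) (x : Weight m) (k : ℤ) :
    coordSeq x (k - 1) = coordSeq x k + x (simpleCoroot (residue m k)) := by
  obtain ⟨h1, h2⟩ := sub_one_residue hm k
  rw [apply_simpleCoroot', coordSeq, coordSeq, h1, h2]
  split_ifs <;> push_cast <;> ring

/-- A simple reflection acts on coordinate sequences by a permutation of the integers. -/
theorem exists_perm_simpleReflection (hm : 2 ≤ m) {s : Weight m ≃ₗ[ℂ] Weight m}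
    (hs : s ∈ simpleReflections m) :
    ∃ p : Equiv.Perm ℤ, ∀ x k, coordSeq (s x) k = coordSeq x (p k) := by
  obtain ⟨i, hi⟩ := hs
  have hne := pred_ne_self hm i
  have hsub : ∀ k, residue m (k - 1) = residue m k - 1 := fun k => (sub_one_residue hm k).1
  have hadd : ∀ k, residue m (k + 1) = residue m k + 1 := fun k => by
    have := hsub (k + 1)
    rw [add_sub_cancel_right] at this
    rw [this, sub_add_cancel]
  -- The reflection exchanges `k - 1` and `k` simultaneously for all `k` congruent to `i` modulo
  -- `m`.
  let f : ℤ → ℤ := fun k =>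
    if residue m k = i then k - 1 else if residue m k = i - 1 then k + 1 else k
  have hf : Function.Involutive f := by
    intro k
    by_cases h : residue m k = i
    · have h1 : residue m (k - 1) = i - 1 := by rw [hsub, h]
      have : f k = k - 1 := if_pos h
      rw [this]
      simp [f, h1, hne]
    by_cases h' : residue m k = i - 1
    · have h1 : residue m (k + 1) = i := by rw [hadd, h', sub_add_cancel]
      have : f k = k + 1 := by simp [f, h', hne]
      rw [this]
      simp [f, h1]
    · have : f k = k := by simp [f, h, h']
      rw [this, this]
  refine ⟨hf.toPerm, fun x k => ?_⟩
  have key : coordSeq (s x) k = coordSeq x k - x (simpleCoroot i) *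
      ((if residue m k = i - 1 then 1 else 0) - if residue m k = i then 1 else 0) := by
    rw [← finCoord_simpleRoot, hi, coordSeq, coordSeq]
    rw [LinearMap.sub_apply, LinearMap.smul_apply, simpleRoot_cElt, classical_sub,
      classical_smul]
    simp only [finCoord, LinearMap.sub_apply, LinearMap.smul_apply, smul_eq_mul]
    ring
  rw [key]
  change _ = coordSeq x (f k)
  by_cases h : residue m k = i
  · have : f k = k - 1 := if_pos h
    rw [this, coordSeq_sub_one hm, h, if_neg hne.symm]; simp
  by_cases h' : residue m k = i - 1
  · have : f k = k + 1 := by simp [f, h', hne]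
    have h2 := coordSeq_sub_one hm x (k + 1)
    rw [hadd, h', sub_add_cancel, add_sub_cancel_right] at h2
    rw [this, h2, h']; simp [hne]
  · have : f k = k := by simp [f, h, h']
    rw [this]; simp [h, h']

theorem exists_perm_weylGroup (hm : 2 ≤ m) {w : Weight m ≃ₗ[ℂ] Weight m}
    (hw : w ∈ weylGroup m) :
    ∃ p : Equiv.Perm ℤ, ∀ x k, coordSeq (w x) k = coordSeq x (p k) := by
  refine weylGroup_induction hm
    (p := fun w => ∃ p : Equiv.Perm ℤ, ∀ x k, coordSeq (w x) k = coordSeq x (p k))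
    ⟨1, fun _ _ => rfl⟩ ?_ hw
  rintro s hs w ⟨p, hp⟩
  obtain ⟨q, hq⟩ := exists_perm_simpleReflection hm hs
  exact ⟨q.trans p, fun x k => (hq (w x) k).trans (hp x _)⟩

/-- The invariant quadratic form. -/
def normForm (x : Weight m) : ℂ :=
  ∑ a, finCoord (classical x) a ^ 2 + 2 * x (cElt m) * x (dElt m)

theorem normForm_weylGroup (hm : 2 ≤ m) {w : Weight m ≃ₗ[ℂ] Weight m} (hw : w ∈ weylGroup m)
    (x : Weight m) : normForm (w x) = normForm x := by
  refine weylGroup_induction hm (p := fun w => normForm (w x) = normForm x) rfl ?_ hw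
  rintro s ⟨i, hi⟩ w ih
  rw [← ih]
  change normForm (s (w x)) = _
  generalize w x = y
  have hne := pred_ne_self hm i
  have hn := apply_simpleCoroot' y i
  rw [hi]
  set n := y (simpleCoroot i)
  have h1 : ∀ a, finCoord (classical (y - n • simpleRoot i)) a ^ 2 =
      finCoord (classical y) a ^ 2 +
      (if a = i - 1 then -2 * n * finCoord (classical y) a + n ^ 2 else 0) +
      (if a = i then 2 * n * finCoord (classical y) a + n ^ 2 else 0) := by
    intro a
    have : finCoord (classical (y - n • simpleRoot i)) a = finCoord (classical y) a -
        n * finCoord (classical (simpleRoot i)) a := rfl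
    rw [this, finCoord_simpleRoot]
    by_cases h : a = i - 1
    · subst h; simp [hne]; ring
    by_cases h' : a = i
    · subst h'; simp [hne.symm]; ring
    · simp [h, h']
  simp only [normForm, h1, Finset.sum_add_distrib, Finset.sum_ite_eq', Finset.mem_univ, if_true,
    LinearMap.sub_apply, LinearMap.smul_apply, simpleRoot_cElt, simpleRoot_dElt, smul_eq_mul]
  split_ifs at hn ⊢
  · linear_combination 2 * n * hn
  · linear_combination 2 * n * hn

/-! ### Free action on strictly dominant weights -/

theorem coordSeq_strictAnti (hm : 2 ≤ m) {x : Weight m} (hx : IsStrictlyDominant x) :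
    StrictAnti fun k => (coordSeq x k).re := by
  refine strictAnti_int_of_succ_lt fun k => ?_
  have h := coordSeq_sub_one hm x (k + 1)
  obtain ⟨n, hn⟩ := hx (residue m (k + 1))
  rw [add_sub_cancel_right, hn] at h
  rw [h]; simp
  positivity

theorem sum_coordSeq (x : Weight m) : ∑ a : Fin m, coordSeq x ((a : ℕ) : ℤ) = 0 := by
  simp only [coordSeq_coe, sum_finCoord]

/-- Coordinate sequences do not see the value at `d`. The invariant form recovers it at nonzero
level, and linearity extends this to level zero by adding `c^*`. -/
theorem eq_one_of_perm_eq_one (hm : 2 ≤ m) {w : Weight m ≃ₗ[ℂ] Weight m}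
    (hw : w ∈ weylGroup m) (h : ∀ x k, coordSeq (w x) k = coordSeq x k) : w = 1 := by
  have hcl : ∀ x, classical (w x) = classical x := fun x => ext_finCoord fun a => by
    rw [← coordSeq_coe, ← coordSeq_coe, h]
  have hd : ∀ x : Weight m, x (cElt m) ≠ 0 → w x (dElt m) = x (dElt m) := by
    intro x hx
    have hn := normForm_weylGroup hm hw x
    rw [normForm, normForm, hcl, weylGroup_cElt hm hw] at hn
    exact mul_left_cancel₀ (mul_ne_zero two_ne_zero hx) (add_left_cancel hn)
  ext1 x
  refine ext_weight (hcl x) (weylGroup_cElt hm hw x) ?_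
  change w x (dElt m) = x (dElt m)
  by_cases hx : x (cElt m) = 0
  · have h1 := hd (x + cStar m) (by simp [hx])
    have h2 := hd (cStar m) (by simp)
    rw [map_add, LinearMap.add_apply, LinearMap.add_apply, h2] at h1
    exact add_right_cancel h1
  · exact hd x hx

/-- A nontrivial element of the Weyl group moves a strictly dominant weight out of the set of
strictly dominant weights, even modulo `δ`. -/
theorem eq_one_of_isStrictlyDominant (hm : 2 ≤ m) {w : Weight m ≃ₗ[ℂ] Weight m}
    (hw : w ∈ weylGroup m) {x y : Weight m} (hx : IsStrictlyDominant x)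
    (hy : IsStrictlyDominant y) (hc : x (cElt m) = y (cElt m))
    (h : classical (w x) = classical y) : w = 1 := by
  obtain ⟨p, hp⟩ := exists_perm_weylGroup hm hw
  have hxa := coordSeq_strictAnti hm hx
  have hya := coordSeq_strictAnti hm hy
  have hpy : ∀ k, coordSeq y k = coordSeq x (p k) := fun k => by
    rw [← hp, coordSeq, coordSeq, h, weylGroup_cElt hm hw, hc]
  have hmono : StrictMono p := by
    intro k k' hk
    have : (coordSeq y k').re < (coordSeq y k).re := hya hk
    rw [hpy, hpy] at this
    exact hxa.lt_iff_gt.mp this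
  -- An increasing permutation of `ℤ` commutes with the successor, hence is a translation.
  let o : ℤ ≃o ℤ := ⟨p, hmono.le_iff_le⟩
  have hstep : ∀ k, p (k + 1) = p k + 1 := fun k => by
    have := o.map_succ k
    rwa [Order.succ_eq_add_one, Order.succ_eq_add_one] at this
  have htrans : ∀ k, p k = k + p 0 := by
    intro k
    induction k using Int.induction_on with
    | zero => simp
    | succ k ih => rw [hstep, ih]; ring
    | pred k ih =>
      have := hstep (-k - 1)
      rw [sub_add_cancel, ih] at this
      linarith
  -- Both sums over a period vanish, while a nonzero translation of a strictly decreasing sequence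
  -- would change the sum.
  have hsum : ∑ a : Fin m, (coordSeq x (((a : ℕ) : ℤ) + p 0)).re =
      ∑ a : Fin m, (coordSeq x ((a : ℕ) : ℤ)).re := by
    rw [← Complex.re_sum, ← Complex.re_sum, sum_coordSeq]
    simp_rw [← htrans, ← hpy, sum_coordSeq]
  have hzero : p 0 = 0 := by
    rcases lt_trichotomy (p 0) 0 with h0 | h0 | h0
    · refine absurd hsum (ne_of_gt (Finset.sum_lt_sum_of_nonempty ⟨0, Finset.mem_univ _⟩ ?_))
      exact fun a _ => hxa (by linarith)
    · exact h0
    · refine absurd hsum (ne_of_lt (Finset.sum_lt_sum_of_nonempty ⟨0, Finset.mem_univ _⟩ ?_))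
      exact fun a _ => hxa (by linarith)
  refine eq_one_of_perm_eq_one hm hw fun z k => ?_
  rw [hp, htrans, hzero, add_zero]

/-- The orbit map of a strictly dominant weight is injective, even modulo `δ`. -/
theorem classical_orbit_injective (hm : 2 ≤ m) {x : Weight m} (hx : IsStrictlyDominant x) :
    Function.Injective fun w : weylGroup m =>
      classical ((w : Weight m ≃ₗ[ℂ] Weight m) x) := by
  have hcl : ∀ {w : Weight m ≃ₗ[ℂ] Weight m}, w ∈ weylGroup m → ∀ y z : Weight m,
      y (cElt m) = z (cElt m) → classical y = classical z →
        classical (w y) = classical (w z) := by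
    intro w hw y z hc hyz
    obtain ⟨p, hp⟩ := exists_perm_weylGroup hm hw
    refine ext_finCoord fun a => ?_
    rw [← coordSeq_coe, ← coordSeq_coe, hp, hp, coordSeq, coordSeq, hc, hyz]
  intro v w hvw
  have h1 : (w⁻¹ * v : Weight m ≃ₗ[ℂ] Weight m) ∈ weylGroup m := mul_mem (inv_mem w.2) v.2
  have h2 := hcl (inv_mem w.2) _ _
    (by rw [weylGroup_cElt hm v.2, weylGroup_cElt hm w.2]) hvw
  have h3 := eq_one_of_isStrictlyDominant hm h1 hx hx rfl
    (h2.trans (congrArg classical (LinearEquiv.symm_apply_apply _ _)))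
  exact (Subtype.ext (inv_mul_eq_one.mp h3)).symm

end WeylGroup

/-! ### Refined multinomial coefficients -/

section Multinomial

variable {m : ℕ}

theorem one_sub_X_pow_ne_zero (n : ℕ) : (1 - RatFunc.X ^ (n + 1) : RatFunc ℚ) ≠ 0 := by
  intro h
  have h1 : (RatFunc.X : RatFunc ℚ) ^ (n + 1) = 1 := (sub_eq_zero.mp h).symm
  rw [← RatFunc.algebraMap_X, ← map_pow, ← map_one (algebraMap (Polynomial ℚ) (RatFunc ℚ))] at h1
  have h2 := congrArg (Polynomial.eval 0) (RatFunc.algebraMap_injective ℚ h1)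
  simp at h2

theorem qPoch_ne_zero (n : ℕ) : qPoch n ≠ 0 :=
  Finset.prod_ne_zero_iff.mpr fun i _ => one_sub_X_pow_ne_zero i

theorem qPoch_succ (n : ℕ) : qPoch (n + 1) = qPoch n * (1 - RatFunc.X ^ (n + 1)) :=
  Finset.prod_range_succ _ n

theorem qPoch_zero : qPoch 0 = 1 := Finset.prod_range_zero _

/-- `β` has sum `N`, and `D` is the corresponding weight of the `N`-th tensor power of the vector
representation. -/
def HasContent (N : ℕ) (D : FinWeight m) (beta : Fin m → ℕ) : Prop :=
  ∑ a, beta a = N ∧ D = ∑ a, (beta a : ℂ) • finE a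

/-- Since the `ē_a` sum to zero, `D` fixes `β` only up to a constant; the total `N` fixes the
constant. -/
theorem HasContent.unique {N : ℕ} {D : FinWeight m} {beta beta' : Fin m → ℕ}
    (h : HasContent N D beta) (h' : HasContent N D beta') : beta = beta' := by
  funext a
  have h1 := congrArg (finCoord · a) (h.2.symm.trans h'.2)
  simp only [finCoord_sum, ← Nat.cast_sum, h.1, h'.1] at h1
  exact_mod_cast sub_left_injective h1

open Classical in
/-- The generating function of the words of content `β`, weighted by the ascents of the words
with the letter `a` put in front. -/
def refinedMultinomial (N : ℕ) (D : FinWeight m) (a : Fin m) : RatFunc ℚ :=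
  if h : ∃ beta, HasContent N D beta then
    RatFunc.X ^ (∑ c ∈ Finset.Ioi a, h.choose c) * (qPoch N / ∏ c, qPoch (h.choose c))
  else 0

theorem HasContent.refinedMultinomial_eq {N : ℕ} {D : FinWeight m} {beta : Fin m → ℕ}
    (h : HasContent N D beta) (a : Fin m) :
    refinedMultinomial N D a =
      RatFunc.X ^ (∑ c ∈ Finset.Ioi a, beta c) * (qPoch N / ∏ c, qPoch (beta c)) := by
  have h' : ∃ beta, HasContent N D beta := ⟨beta, h⟩
  rw [refinedMultinomial, dif_pos h', h'.choose_spec.unique h]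

theorem refinedMultinomial_eq_zero {N : ℕ} {D : FinWeight m}
    (h : ¬ ∃ beta, HasContent N D beta) (a : Fin m) : refinedMultinomial N D a = 0 :=
  dif_neg h

theorem refinedMultinomial_last {N : ℕ} (x y : Weight m) {a : Fin m} (ha : (a : ℕ) + 1 = m) :
    refinedMultinomial N (classical x - classical y) a = qMultinomial N x y := by
  have hI : Finset.Ioi a = ∅ := by
    ext c
    simp only [Finset.mem_Ioi, Finset.notMem_empty, iff_false, Fin.lt_def]
    omega
  by_cases h : ∃ beta, HasContent N (classical x - classical y) beta
  · have h' : ∃ beta, IsComposition N x y beta := h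
    rw [h.choose_spec.refinedMultinomial_eq, hI, Finset.sum_empty, pow_zero, one_mul,
      qMultinomial, dif_pos h']
    rfl
  · have h' : ¬ ∃ beta, IsComposition N x y beta := h
    rw [refinedMultinomial_eq_zero h, qMultinomial, dif_neg h']

open Classical in
theorem refinedMultinomial_zero (D : FinWeight m) (a : Fin m) :
    refinedMultinomial 0 D a = if D = 0 then 1 else 0 := by
  split_ifs with h
  · have : HasContent 0 D (fun _ => 0) := ⟨by simp, by simp [h]⟩
    rw [this.refinedMultinomial_eq]
    simp [qPoch_zero]
  · refine refinedMultinomial_eq_zero (fun ⟨beta, h1, h2⟩ => h ?_) a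
    have h3 : ∀ a, beta a = 0 := fun a => (Finset.sum_eq_zero_iff.mp h1) a (Finset.mem_univ a)
    rw [h2]; simp [h3]

theorem HasContent.cons {N : ℕ} {D : FinWeight m} {beta : Fin m → ℕ} {b : Fin m}
    (h : HasContent N (D - finE b) beta) :
    HasContent (N + 1) D (beta + Pi.single b 1) := by
  refine ⟨by simp [Finset.sum_add_distrib, h.1], ?_⟩
  rw [sub_eq_iff_eq_add.mp h.2]
  simp [add_smul, Finset.sum_add_distrib, Pi.single_apply]

/-- With tail sums `s k = ∑_{c ≥ k} β_c`, each term is a multiple of `X ^ s (b + 1) - X ^ s b`. The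
ranges `b ≤ a` and `b > a` telescope separately. -/
theorem sum_telescope (beta : Fin m → ℕ) (N : ℕ) (hN : ∑ c, beta c = N) (a : Fin m) :
    ∑ b, (if a < b then (RatFunc.X : RatFunc ℚ) ^ N else 1) *
        (RatFunc.X ^ (∑ c ∈ Finset.Ioi b, beta c) * (1 - RatFunc.X ^ beta b)) =
      RatFunc.X ^ (∑ c ∈ Finset.Ioi a, beta c) * (1 - RatFunc.X ^ N) := by
  set s : ℕ → ℕ := fun k => ∑ c ∈ Finset.univ.filter (fun c : Fin m => k ≤ (c : ℕ)), beta c with hs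
  have hIoi : ∀ b : Fin m, ∑ c ∈ Finset.Ioi b, beta c = s (b + 1) := by
    intro b
    refine Finset.sum_congr ?_ fun _ _ => rfl
    ext c; simp only [Finset.mem_Ioi, Finset.mem_filter, Finset.mem_univ, true_and]; omega
  have hsucc : ∀ b : Fin m, s b = s (b + 1) + beta b := by
    intro b
    rw [← hIoi, add_comm, ← Finset.sum_insert (by simp)]
    refine Finset.sum_congr ?_ fun _ _ => rfl
    ext c
    simp only [Finset.mem_insert, Finset.mem_Ioi, Finset.mem_filter, Finset.mem_univ, true_and]
    omega
  have h0 : s 0 = N := by simp [hs, hN]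
  have hm : s m = 0 := by
    refine Finset.sum_eq_zero fun c hc => ?_
    simp only [Finset.mem_filter] at hc
    omega
  let f : ℕ → RatFunc ℚ := fun k => (if (a : ℕ) < k then RatFunc.X ^ N else 1) *
    (RatFunc.X ^ s (k + 1) - RatFunc.X ^ s k)
  have h1 : ∀ b : Fin m, (if a < b then (RatFunc.X : RatFunc ℚ) ^ N else 1) *
      (RatFunc.X ^ (∑ c ∈ Finset.Ioi b, beta c) * (1 - RatFunc.X ^ beta b)) = f b := by
    intro b
    simp only [f, hIoi, hsucc b, Fin.lt_def]
    ring
  rw [Finset.sum_congr rfl fun b _ => h1 b, Fin.sum_univ_eq_sum_range f m,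
    ← Finset.sum_range_add_sum_Ico f (show (a : ℕ) + 1 ≤ m from a.2)]
  have h2 : ∑ k ∈ Finset.range (a + 1), f k = RatFunc.X ^ s (a + 1) - RatFunc.X ^ N := by
    rw [← h0, ← Finset.sum_range_sub (fun k => (RatFunc.X : RatFunc ℚ) ^ s k)]
    refine Finset.sum_congr rfl fun k hk => ?_
    rw [Finset.mem_range] at hk
    simp [f, show ¬ (a : ℕ) < k by omega]
  have h3 : ∑ k ∈ Finset.Ico ((a : ℕ) + 1) m, f k =
      RatFunc.X ^ N * (1 - RatFunc.X ^ s (a + 1)) := by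
    have : ∀ k ∈ Finset.Ico ((a : ℕ) + 1) m, f k =
        RatFunc.X ^ N * (RatFunc.X ^ s (k + 1) - RatFunc.X ^ s k) := by
      intro k hk
      rw [Finset.mem_Ico] at hk
      simp [f, show (a : ℕ) < k by omega]
    rw [Finset.sum_congr rfl this, ← Finset.mul_sum,
      Finset.sum_Ico_sub (fun k => (RatFunc.X : RatFunc ℚ) ^ s k) a.2, hm, pow_zero]
  rw [h2, h3, hIoi]
  ring

/-- The recursion for the refined multinomial coefficients. -/
theorem refinedMultinomial_succ (N : ℕ) (D : FinWeight m) (a : Fin m) :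
    refinedMultinomial (N + 1) D a =
      ∑ b, (if a < b then RatFunc.X ^ (N + 1) else 1) *
        refinedMultinomial N (D - finE b) b := by
  by_cases h : ∃ beta, HasContent (N + 1) D beta
  · obtain ⟨beta, h⟩ := h
    -- Removing a letter `b` costs a factor `1 - X ^ β_b` of the denominator and leaves the letters
    -- above `b` untouched. If `b` does not occur, that factor is zero, as it should be.
    have key : ∀ b, refinedMultinomial N (D - finE b) b =
        (RatFunc.X ^ (∑ c ∈ Finset.Ioi b, beta c) * (1 - RatFunc.X ^ beta b)) *
          (qPoch N / ∏ c, qPoch (beta c)) := by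
      intro b
      by_cases hb : beta b = 0
      · rw [hb, pow_zero, sub_self, mul_zero, zero_mul]
        refine refinedMultinomial_eq_zero (fun ⟨beta', h'⟩ => ?_) b
        have := congrFun (h.unique h'.cons) b
        simp [hb] at this
      · obtain ⟨k, hk⟩ := Nat.exists_eq_succ_of_ne_zero hb
        let beta' := Function.update beta b k
        have hbeta : beta = beta' + Pi.single b 1 := by
          funext c
          rcases eq_or_ne c b with rfl | hc
          · simp [beta', hk]
          · simp [beta', hc]
        have h' : HasContent N (D - finE b) beta' := by
          constructor
          · have := h.1
            rw [hbeta] at this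
            simpa [Finset.sum_add_distrib] using this
          · rw [h.2, hbeta]
            simp [add_smul, Finset.sum_add_distrib, Pi.single_apply]
        have h1 : ∏ c, qPoch (beta c) = (∏ c, qPoch (beta' c)) * (1 - RatFunc.X ^ beta b) := by
          rw [← Finset.mul_prod_erase _ _ (Finset.mem_univ b),
            ← Finset.mul_prod_erase _ (fun c => qPoch (beta' c)) (Finset.mem_univ b), hk,
            Nat.succ_eq_add_one, qPoch_succ]
          have : ∏ c ∈ Finset.univ.erase b, qPoch (beta c) =
              ∏ c ∈ Finset.univ.erase b, qPoch (beta' c) :=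
            Finset.prod_congr rfl fun c hc => by
              simp [beta', Finset.ne_of_mem_erase hc]
          rw [this, show beta' b = k from Function.update_self ..]
          ring
        have h2 : ∑ c ∈ Finset.Ioi b, beta' c = ∑ c ∈ Finset.Ioi b, beta c :=
          Finset.sum_congr rfl fun c hc => by
            simp [beta', (Finset.mem_Ioi.mp hc).ne']
        have h3 : (1 - RatFunc.X ^ beta b : RatFunc ℚ) ≠ 0 := by
          rw [hk]; exact one_sub_X_pow_ne_zero k
        have h4 : ∏ c, qPoch (beta' c) ≠ 0 :=
          Finset.prod_ne_zero_iff.mpr fun c _ => qPoch_ne_zero _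
        rw [h'.refinedMultinomial_eq, h1, h2]
        field_simp
    simp_rw [key, ← mul_assoc, ← Finset.sum_mul]
    have := sum_telescope beta (N + 1) h.1 a
    simp_rw [← mul_assoc] at this
    rw [this, h.refinedMultinomial_eq, qPoch_succ]
    ring
  · rw [refinedMultinomial_eq_zero h, Finset.sum_eq_zero]
    intro b _
    rw [refinedMultinomial_eq_zero (fun ⟨beta, h'⟩ => h ⟨_, h'.cons⟩), mul_zero]

variable [NeZero m]

/-- A weight of level zero, its image under a simple reflection, and the corresponding refined
multinomial coefficients. -/
theorem refinedMultinomial_reflection (hm : 2 ≤ m) (N : ℕ) (x : Weight m) (hx : x (cElt m) = 0)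
    (i : Fin m) (n : ℤ) (hn : x (simpleCoroot i) = n) :
    refinedMultinomial N (classical x) i =
      RatFunc.X ^ (if i = 0 then n else 0) *
        refinedMultinomial N (classical (x - x (simpleCoroot i) • simpleRoot i)) i := by
  have hX : (RatFunc.X : RatFunc ℚ) ≠ 0 := RatFunc.X_ne_zero
  have swap : ∀ y : Weight m, y (cElt m) = 0 → ∀ beta, HasContent N (classical y) beta →
      y (simpleCoroot i) = beta (i - 1) - beta i ∧
      HasContent N (classical (y - y (simpleCoroot i) • simpleRoot i))
        (fun a => beta (Equiv.swap (i - 1) i a)) := by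
    intro y hy beta hb
    have h1 : y (simpleCoroot i) = beta (i - 1) - beta i := by
      rw [apply_simpleCoroot', hy, hb.2, finCoord_sum, finCoord_sum]
      simp
    refine ⟨h1, ?_, ?_⟩
    · rw [Equiv.sum_comp (Equiv.swap (i - 1) i) beta, hb.1]
    · rw [sum_smul_finE_swap (fun a => (beta a : ℂ)), ← hb.2, ← h1, ← classical_simpleRoot]; rfl
  by_cases h : ∃ beta, HasContent N (classical x) beta
  · obtain ⟨beta, hb⟩ := h
    obtain ⟨h1, h2⟩ := swap x hx beta hb
    rw [hb.refinedMultinomial_eq, h2.refinedMultinomial_eq,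
      Equiv.prod_comp (Equiv.swap (i - 1) i) (fun c => qPoch (beta c)), ← mul_assoc]
    congr 1
    -- For `i = 0` the exponent is `N - β_0`, so exchanging `β_0` with the last entry of `β` shifts
    -- it by `n`. Otherwise `i - 1` and `i` both lie outside the range `c > i`, and the exponent is
    -- unchanged.
    split_ifs with hi
    · have hn' : n = beta (i - 1) - beta i := by
        rw [hn] at h1; exact_mod_cast h1
      have hsum : ∀ b : Fin m → ℕ, ∑ c, b c = b i + ∑ c ∈ Finset.Ioi i, b c := by
        intro b
        have : Finset.Ioi i = Finset.univ.erase i := by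
          ext c; simp [hi, Fin.pos_iff_ne_zero]
        rw [this, Finset.add_sum_erase _ _ (Finset.mem_univ i)]
      have e1 := hsum beta
      have e2 := hsum fun a => beta (Equiv.swap (i - 1) i a)
      rw [hb.1] at e1
      rw [h2.1, Equiv.swap_apply_right] at e2
      rw [← zpow_natCast, ← zpow_natCast, ← zpow_add₀ hX]
      congr 1
      omega
    · rw [zpow_zero, one_mul]
      congr 1
      refine Finset.sum_congr rfl fun c hc => ?_
      have hc := Finset.mem_Ioi.mp hc
      rw [Equiv.swap_apply_of_ne_of_ne _ hc.ne']
      intro h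
      have := Fin.val_ne_of_ne hi
      rw [h, Fin.lt_def, Fin.val_sub_one_of_ne_zero hi] at hc
      omega
  · rw [refinedMultinomial_eq_zero h, refinedMultinomial_eq_zero, mul_zero]
    rintro ⟨beta, hb⟩
    have hc : (x - x (simpleCoroot i) • simpleRoot i) (cElt m) = 0 := by
      rw [LinearMap.sub_apply, LinearMap.smul_apply, simpleRoot_cElt, hx, smul_zero, sub_zero]
    have h1 := (swap _ hc beta hb).2
    have h2 : classical (x - x (simpleCoroot i) • simpleRoot i -
        (x - x (simpleCoroot i) • simpleRoot i) (simpleCoroot i) • simpleRoot i) =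
          classical x := by
      rw [LinearMap.sub_apply, LinearMap.smul_apply, simpleRoot_simpleCoroot hm]
      congr 1
      module
    rw [h2] at h1
    exact h ⟨_, h1⟩

end Multinomial

/-! ### Words -/

section Words

variable {m : ℕ}

/-- The position after `k` steps of the path from `y` with steps `v`. -/
def position (y : Weight m) {n : ℕ} (v : Fin n → Fin m) (k : ℕ) : Weight m :=
  y + ∑ i : Fin n, if (i : ℕ) < k then eBar (v i) else 0

theorem position_zero (y : Weight m) {n : ℕ} (v : Fin n → Fin m) : position y v 0 = y := by
  simp [position]

theorem position_cons (y : Weight m) {n : ℕ} (b : Fin m) (v : Fin n → Fin m) (k : ℕ) :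
    position y (Fin.cons b v : Fin (n + 1) → Fin m) (k + 1) = position (y + eBar b) v k := by
  simp [position, Fin.sum_univ_succ, add_assoc]

/-- The weighted number of ascents of the word `v` preceded by `a`. -/
def energy (a : Fin m) {n : ℕ} (v : Fin n → Fin m) : ℕ :=
  ∑ i : Fin n, if (Fin.cons a v : Fin (n + 1) → Fin m) i.castSucc < v i then n - i else 0

theorem energy_cons (a b : Fin m) {n : ℕ} (v : Fin n → Fin m) :
    energy a (Fin.cons b v : Fin (n + 1) → Fin m) =
      (if a < b then n + 1 else 0) + energy b v := by
  simp only [energy, Fin.sum_univ_succ, Fin.castSucc_zero, Fin.cons_zero, Fin.val_zero,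
    Nat.sub_zero, ← Fin.succ_castSucc, Fin.cons_succ, Fin.val_succ, Nat.add_sub_add_right]

end Words

/-! ### The alternating sum over the Weyl group -/

section AlternatingSum

variable {m : ℕ} [NeZero m]

/-- The alternating sum of refined multinomial coefficients over the orbit of `x`. -/
def alternatingSum (x : Weight m) (e : weylGroup m → ℤ) (N : ℕ) (y : Weight m) (a : Fin m) :
    RatFunc ℚ :=
  ∑ᶠ w : weylGroup m, (sign w : RatFunc ℚ) * RatFunc.X ^ e w *
    refinedMultinomial N (classical ((w : Weight m ≃ₗ[ℂ] Weight m) x) - classical y) a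

/-- The entries of `β` are at most `N`, so only finitely many classes occur, and each is reached by
at most one `w`. -/
theorem finite_setOf_hasContent (hm : 2 ≤ m) {x : Weight m} (hx : IsStrictlyDominant x) (N : ℕ)
    (D : FinWeight m) :
    {w : weylGroup m | ∃ beta,
      HasContent N (classical ((w : Weight m ≃ₗ[ℂ] Weight m) x) - D) beta}.Finite := by
  have h1 : {C : FinWeight m | ∃ beta, HasContent N (C - D) beta}.Finite := by
    refine ((Set.finite_Iic (fun _ : Fin m => N)).image
      fun beta => ∑ a, (beta a : ℂ) • finE a + D).subset ?_
    rintro C ⟨beta, h, h'⟩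
    refine ⟨beta, fun a => ?_, (sub_eq_iff_eq_add.mp h').symm⟩
    rw [← h]
    exact Finset.single_le_sum (fun _ _ => Nat.zero_le _) (Finset.mem_univ a)
  have h2 := h1.preimage (f := fun w : weylGroup m =>
    classical ((w : Weight m ≃ₗ[ℂ] Weight m) x)) (classical_orbit_injective hm hx).injOn
  exact h2

theorem finite_support_alternatingSum (hm : 2 ≤ m) {x : Weight m} (hx : IsStrictlyDominant x)
    (e : weylGroup m → ℤ) (N : ℕ) (D : FinWeight m) (a : Fin m) :
    (Function.support fun w : weylGroup m => (sign w : RatFunc ℚ) * RatFunc.X ^ e w *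
      refinedMultinomial N (classical ((w : Weight m ≃ₗ[ℂ] Weight m) x) - D) a).Finite := by
  refine (finite_setOf_hasContent hm hx N D).subset fun w hw => ?_
  by_contra h
  exact hw (by simp only [refinedMultinomial_eq_zero h, mul_zero])

open Classical in
theorem alternatingSum_zero (hm : 2 ≤ m) {x y : Weight m} (hx : IsStrictlyDominant x)
    (hy : IsStrictlyDominant y) (hc : x (cElt m) = y (cElt m)) (e : weylGroup m → ℤ)
    (he : e 1 = 0) (a : Fin m) :
    alternatingSum x e 0 y a = if classical x = classical y then 1 else 0 := by
  rw [alternatingSum, finsum_eq_single _ 1]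
  · rw [sign_one hm, he, refinedMultinomial_zero]
    simp [sub_eq_zero]
  · intro w hw
    rw [refinedMultinomial_zero, if_neg, mul_zero]
    intro h
    exact hw (Subtype.ext
      (eq_one_of_isStrictlyDominant hm w.2 hx hy hc (sub_eq_zero.mp h)))

theorem alternatingSum_succ (hm : 2 ≤ m) {x : Weight m} (hx : IsStrictlyDominant x)
    (e : weylGroup m → ℤ) (N : ℕ) (y : Weight m) (a : Fin m) :
    alternatingSum x e (N + 1) y a =
      ∑ b, (if a < b then RatFunc.X ^ (N + 1) else 1) * alternatingSum x e N (y + eBar b) b := by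
  have h1 : ∀ b, (if a < b then (RatFunc.X : RatFunc ℚ) ^ (N + 1) else 1) *
      alternatingSum x e N (y + eBar b) b =
        ∑ᶠ w : weylGroup m, (if a < b then RatFunc.X ^ (N + 1) else 1) *
          ((sign w : RatFunc ℚ) * RatFunc.X ^ e w * refinedMultinomial N
            (classical ((w : Weight m ≃ₗ[ℂ] Weight m) x) - classical (y + eBar b)) b) :=
    fun b => mul_finsum _ _
  simp_rw [h1]
  rw [← finsum_sum_comm]
  · refine finsum_congr fun w => ?_
    rw [refinedMultinomial_succ, Finset.mul_sum]
    refine Finset.sum_congr rfl fun b _ => ?_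
    rw [classical_add, classical_eBar, sub_add_eq_sub_sub]
    ring
  · intro b _
    exact (finite_support_alternatingSum hm hx e N _ b).subset
      fun w hw => right_ne_zero_of_mul hw

/-- Left multiplication by `σ_i` negates every term, so the sum is its own negative. This needs `y`
on the wall of `σ_i` and the preceding letter to be that same `i`. -/
theorem alternatingSum_eq_zero (hm : 2 ≤ m) {x y : Weight m} (hx : IsIntegral x)
    (hc : x (cElt m) = y (cElt m)) (e : weylGroup m → ℤ)
    (he : ∀ w : weylGroup m, (e w : ℂ) =
      x (dElt m) - (w : Weight m ≃ₗ[ℂ] Weight m) x (dElt m))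
    (i : Fin m) (hi : y (simpleCoroot i) = 0) (N : ℕ) : alternatingSum x e N y i = 0 := by
  obtain ⟨s, hs, hs'⟩ := exists_simpleReflection hm i
  let s' : weylGroup m := ⟨s, simpleReflection_mem_weylGroup hs⟩
  have key : ∀ w : weylGroup m, (sign (s' * w) : RatFunc ℚ) * RatFunc.X ^ e (s' * w) *
      refinedMultinomial N (classical (((s' * w : weylGroup m) : Weight m ≃ₗ[ℂ] Weight m) x) -
        classical y) i =
      -((sign w : RatFunc ℚ) * RatFunc.X ^ e w *
        refinedMultinomial N (classical ((w : Weight m ≃ₗ[ℂ] Weight m) x) - classical y) i) := by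
    intro w
    obtain ⟨n, hn⟩ := (weylGroup_integral hm w.2 hx).1 i
    set z := (w : Weight m ≃ₗ[ℂ] Weight m) x with hz
    have h1 : ((s' * w : weylGroup m) : Weight m ≃ₗ[ℂ] Weight m) x =
        z - z (simpleCoroot i) • simpleRoot i := hs' z
    have h2 : (z - y) (simpleCoroot i) = z (simpleCoroot i) := by
      rw [LinearMap.sub_apply, hi, sub_zero]
    have h3 : (z - y) (cElt m) = 0 := by
      rw [LinearMap.sub_apply, hz, weylGroup_cElt hm w.2, hc, sub_self]
    have h4 := refinedMultinomial_reflection hm N (z - y) h3 i n (h2.trans hn)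
    have h5 : e (s' * w) = e w + if i = 0 then n else 0 := by
      have : (e (s' * w) : ℂ) = ((e w + if i = 0 then n else 0 : ℤ) : ℂ) := by
        rw [he, h1, LinearMap.sub_apply, LinearMap.smul_apply, simpleRoot_dElt, hn]
        push_cast
        rw [he]
        split_ifs <;> simp [hz]
        ring
      exact_mod_cast this
    rw [sign_mul hm (s := s') hs, h1, h5, ← classical_sub, ← classical_sub, h4, h2,
      zpow_add₀ RatFunc.X_ne_zero, sub_right_comm]
    push_cast
    ring
  have h := finsum_comp_equiv (Equiv.mulLeft s') (f := fun w : weylGroup m =>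
    (sign w : RatFunc ℚ) * RatFunc.X ^ e w *
      refinedMultinomial N (classical ((w : Weight m ≃ₗ[ℂ] Weight m) x) - classical y) i)
  simp only [Equiv.coe_mulLeft, key, finsum_neg_distrib] at h
  exact self_eq_neg.mp h.symm

/-! ### Paths in the dominant alcove -/

open Classical in
/-- The generating function of the paths with `N` steps from `y` to the class of `x` in the
strictly dominant chamber, where `a` is the step that led to `y`. -/
def pathSum (x : Weight m) : ℕ → Weight m → Fin m → RatFunc ℚ
  | 0, y, _ => if classical x = classical y then 1 else 0
  | N + 1, y, a => ∑ b, if IsStrictlyDominant (y + eBar b) then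
      (if a < b then RatFunc.X ^ (N + 1) else 1) * pathSum x N (y + eBar b) b else 0

/-- A step out of the strictly dominant chamber leads to a wall. -/
theorem exists_simpleCoroot_eq_zero (hm : 2 ≤ m) {y : Weight m} (hy : IsStrictlyDominant y)
    (b : Fin m) (h : ¬ IsStrictlyDominant (y + eBar b)) : (y + eBar b) (simpleCoroot b) = 0 := by
  by_contra h0
  refine h fun i => ?_
  have hne := pred_ne_self hm b
  obtain ⟨k, hk⟩ := hy i
  rw [LinearMap.add_apply, hk, eBar_simpleCoroot]
  -- Adding `ē_b` lowers only the value on the coroot with index `b`, and by one; a positive integer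
  -- can thus fail to stay positive only by becoming zero.
  rcases eq_or_ne b i with rfl | hi
  · rw [LinearMap.add_apply, hk, eBar_simpleCoroot, if_neg hne.symm, if_pos rfl] at h0
    rw [if_neg hne.symm, if_pos rfl]
    cases k with
    | zero => simp at h0
    | succ k => exact ⟨k, by push_cast; ring⟩
  · rw [if_neg hi]
    split_ifs
    · exact ⟨k + 1, by push_cast; ring⟩
    · exact ⟨k, by ring⟩

theorem pathSum_eq_alternatingSum (hm : 2 ≤ m) {x : Weight m} (hx : IsStrictlyDominant x)
    (e : weylGroup m → ℤ)
    (he : ∀ w : weylGroup m, (e w : ℂ) =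
      x (dElt m) - (w : Weight m ≃ₗ[ℂ] Weight m) x (dElt m))
    (N : ℕ) (y : Weight m) (hy : IsStrictlyDominant y) (hc : x (cElt m) = y (cElt m))
    (a : Fin m) : pathSum x N y a = alternatingSum x e N y a := by
  induction N generalizing y a with
  | zero =>
    have h1 : e 1 = 0 := by
      have h := he 1
      rw [OneMemClass.coe_one] at h
      change (e 1 : ℂ) = x (dElt m) - x (dElt m) at h
      rw [sub_self] at h
      exact_mod_cast h
    rw [alternatingSum_zero hm hx hy hc e h1, pathSum]
  | succ N ih =>
    rw [alternatingSum_succ hm hx, pathSum]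
    refine Finset.sum_congr rfl fun b _ => ?_
    have hc' : x (cElt m) = (y + eBar b) (cElt m) := by
      rw [LinearMap.add_apply, eBar_cElt, add_zero, hc]
    split_ifs with h h' h'
    · rw [ih _ h hc']
    · rw [ih _ h hc']
    · rw [alternatingSum_eq_zero hm hx.isIntegral hc' e he b
        (exists_simpleCoroot_eq_zero hm hy b h), mul_zero]
    · rw [alternatingSum_eq_zero hm hx.isIntegral hc' e he b
        (exists_simpleCoroot_eq_zero hm hy b h), mul_zero]

/-- The words whose paths from `y` to the class of `x` stay in the strictly dominant chamber. -/
def dominantWords (x y : Weight m) (n : ℕ) : Set (Fin n → Fin m) :=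
  {v | (∀ k, 1 ≤ k → k ≤ n → IsStrictlyDominant (position y v k)) ∧
    classical x = classical (position y v n)}

theorem cons_mem_dominantWords (x y : Weight m) {n : ℕ} (b : Fin m) (v : Fin n → Fin m) :
    (Fin.cons b v : Fin (n + 1) → Fin m) ∈ dominantWords x y (n + 1) ↔
      IsStrictlyDominant (y + eBar b) ∧ v ∈ dominantWords x (y + eBar b) n := by
  simp only [dominantWords, Set.mem_ofPred_eq, position_cons, ← and_assoc]
  refine and_congr_left fun _ => ⟨fun h => ⟨?_, fun k h1 h2 => ?_⟩, fun h k h1 h2 => ?_⟩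
  · have := h 1 le_rfl (by omega)
    rwa [position_cons y b v 0, position_zero] at this
  · have := h (k + 1) (by omega) (by omega)
    rwa [position_cons] at this
  · obtain ⟨k, rfl⟩ := Nat.exists_eq_add_of_le' h1
    rw [position_cons]
    rcases Nat.eq_zero_or_pos k with rfl | hk
    · rw [position_zero]; exact h.1
    · exact h.2 k hk (by omega)

open Classical in
theorem pathSum_eq_sum (x : Weight m) (n : ℕ) (y : Weight m) (a : Fin m) :
    pathSum x n y a =
      ∑ v : Fin n → Fin m, if v ∈ dominantWords x y n then RatFunc.X ^ energy a v else 0 := by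
  induction n generalizing y a with
  | zero =>
    rw [pathSum, Fintype.sum_unique]
    refine if_congr ?_ (by simp [energy]) rfl
    rw [dominantWords, Set.mem_ofPred_eq, position_zero]
    exact ⟨fun h => ⟨fun k h1 h2 => by omega, h⟩, fun h => h.2⟩
  | succ n ih =>
    rw [pathSum, ← (Fin.consEquiv fun _ : Fin (n + 1) => Fin m).sum_comp, Fintype.sum_prod_type]
    refine Finset.sum_congr rfl fun b _ => ?_
    have hcons : ∀ v, (Fin.consEquiv fun _ : Fin (n + 1) => Fin m) (b, v) = Fin.cons b v :=
      fun _ => rfl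
    simp only [hcons, cons_mem_dominantWords, energy_cons, ih]
    by_cases h : IsStrictlyDominant (y + eBar b)
    · simp only [h, true_and, if_true, Finset.mul_sum]
      refine Finset.sum_congr rfl fun v _ => ?_
      split_ifs <;> simp [pow_add]
    · simp [h]

end AlternatingSum

/-! ### Tableaux and words -/

section Tableaux

variable {m : ℕ}

/-- The number of occurrences of `a` among the first `k` letters of a word. -/
def letterCount {n : ℕ} (v : Fin n → Fin m) (k : ℕ) (a : Fin m) : ℕ :=
  (Finset.univ.filter fun i : Fin n => (i : ℕ) < k ∧ v i = a).card

theorem sum_letterCount {n : ℕ} (v : Fin n → Fin m) : ∑ a, letterCount v n a = n := by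
  simp only [letterCount, Fin.is_lt, true_and]
  rw [← Finset.card_eq_sum_card_fiberwise fun _ _ => Finset.mem_univ _]
  simp

theorem position_eq {n : ℕ} (y : Weight m) (v : Fin n → Fin m) (k : ℕ) :
    position y v k = y + ∑ a, (letterCount v k a : ℂ) • eBar a := by
  rw [position, ← Finset.sum_filter, ← Finset.sum_fiberwise _ v]
  congr 1
  refine Finset.sum_congr rfl fun a _ => ?_
  rw [Finset.filter_filter, Finset.sum_congr rfl (g := fun _ => eBar a), Finset.sum_const,
    letterCount, Nat.cast_smul_eq_nsmul]
  intro i hi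
  rw [(Finset.mem_filter.mp hi).2.2]

theorem classical_position {n : ℕ} (y : Weight m) (v : Fin n → Fin m) (k : ℕ) :
    classical (position y v k) =
      classical y + ∑ a, (letterCount v k a : ℂ) • finE a := by
  rw [position_eq, classical_add, classical_sum]
  simp only [classical_smul, classical_eBar]

theorem position_cElt {n : ℕ} (y : Weight m) (v : Fin n → Fin m) (k : ℕ) :
    position y v k (cElt m) = y (cElt m) := by
  rw [position_eq, LinearMap.add_apply, LinearMap.sum_apply]
  refine add_eq_left.mpr (Finset.sum_eq_zero fun a _ => ?_)
  rw [LinearMap.smul_apply, eBar_cElt, smul_zero]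

/-! ### Row words and the statistic `d(T)` -/

variable {beta : Fin m → ℕ}

/-- The word of a tableau: the sequence of the rows of its entries. -/
def rowWord (T : Tableau beta) (i : Fin (∑ a, beta a)) : Fin m := (T.symm i).1

theorem rowWord_apply (T : Tableau beta) (x : Cell beta) : rowWord T (T x) = x.1 := by
  rw [rowWord, Equiv.symm_apply_apply]

theorem rowCount_eq (T : Tableau beta) (n : ℕ) (a : Fin m) :
    rowCount T n a = letterCount (rowWord T) n a := by
  rw [rowCount, letterCount, Nat.card_eq_fintype_card, Fintype.card_subtype]
  refine Finset.card_bij (fun k _ => T ⟨a, k⟩) ?_ ?_ ?_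
  · intro k hk
    simpa [rowWord_apply, Nat.succ_le_iff] using hk
  · intro k _ k' _ h
    simpa using h
  · intro i hi
    simp only [Finset.mem_filter, Finset.mem_univ, true_and] at hi
    obtain ⟨hi, rfl⟩ := hi
    refine ⟨(T.symm i).2, ?_, ?_⟩
    · refine Finset.mem_filter.mpr ⟨Finset.mem_univ _, ?_⟩
      change (T (T.symm i) : ℕ) + 1 ≤ n
      rwa [T.apply_symm_apply]
    · exact T.apply_symm_apply i

theorem letterCount_rowWord (T : Tableau beta) (a : Fin m) :
    letterCount (rowWord T) (∑ b, beta b) a = beta a := by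
  rw [← rowCount_eq, rowCount, Nat.card_eq_fintype_card, Fintype.card_subtype,
    Finset.filter_true_of_mem, Finset.card_univ, Fintype.card_fin]
  exact fun k _ => (T ⟨a, k⟩).2

/-- Summation by parts: the increment at `j` enters each of the `n - j` later values. -/
theorem sum_eta {n : ℕ} (f : ℕ → ℤ) (h0 : f 0 = 0) :
    ∑ i ∈ Finset.range (n + 1), f i = ∑ j ∈ Finset.range n, ((n : ℤ) - j) * (f (j + 1) - f j) := by
  induction n with
  | zero => simp [h0]
  | succ n ih =>
    have h1 := Finset.sum_range_sub f (n + 1)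
    have h2 : ∑ j ∈ Finset.range (n + 1), (((n + 1 : ℕ) : ℤ) - j) * (f (j + 1) - f j) =
        ∑ j ∈ Finset.range (n + 1), ((n : ℤ) - j) * (f (j + 1) - f j) +
          ∑ j ∈ Finset.range (n + 1), (f (j + 1) - f j) := by
      rw [← Finset.sum_add_distrib]
      refine Finset.sum_congr rfl fun j _ => ?_
      push_cast; ring
    rw [Finset.sum_range_succ, ih, h2, h1, h0, Finset.sum_range_succ _ n]
    ring

theorem energy_eq_sum {n : ℕ} {a : Fin m} (ha : (a : ℕ) + 1 = m) (v : Fin n → Fin m)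
    (f : ℕ → ℤ) (h0 : f 0 = 0)
    (hf : ∀ (i : ℕ) (h : i + 1 < n),
      f (i + 1) = f i + if v ⟨i, by omega⟩ < v ⟨i + 1, h⟩ then 1 else 0) :
    ∑ i ∈ Finset.range n, f i = (energy a v : ℤ) := by
  cases n with
  | zero => simp [energy]
  | succ n =>
    rw [sum_eta f h0, energy, Fin.sum_univ_succ, Fin.castSucc_zero, Fin.cons_zero,
      if_neg (by rw [Fin.lt_def]; have := (v 0).2; omega), zero_add, Nat.cast_sum,
      ← Fin.sum_univ_eq_sum_range (fun j => ((n : ℤ) - j) * (f (j + 1) - f j))]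
    refine Finset.sum_congr rfl fun j _ => ?_
    rw [hf j (by omega), ← Fin.succ_castSucc, Fin.cons_succ]
    change _ * (_ + (if v j.castSucc < v j.succ then 1 else 0) - _) = _
    split_ifs
    · rw [Fin.val_succ, Nat.add_sub_add_right, Nat.cast_sub j.2.le]; ring
    · simp

theorem baseTableau_lt {x y : Cell beta} (h : x.1 < y.1) :
    baseTableau beta x < baseTableau beta y := by
  let g : ℕ → ℕ := fun i => if hi : i < m then beta ⟨i, hi⟩ else 0
  have hg : ∀ z : Cell beta, (baseTableau beta z : ℕ) = ∑ i ∈ Finset.range z.1, g i + z.2 := by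
    intro z
    rw [baseTableau, finSigmaFinEquiv_apply, ← Fin.sum_univ_eq_sum_range g]
    congr 1
    refine Finset.sum_congr rfl fun i _ => ?_
    have hi : (i : ℕ) < m := i.2.trans z.1.2
    simp only [g, dif_pos hi]
    rfl
  rw [Fin.lt_def, hg, hg]
  have h1 : ∑ i ∈ Finset.range (x.1 + 1), g i ≤ ∑ i ∈ Finset.range y.1, g i :=
    Finset.sum_le_sum_of_subset (Finset.range_mono h)
  have h2 : g x.1 = beta x.1 := dif_pos x.1.2
  rw [Finset.sum_range_succ, h2] at h1
  have h3 := x.2.2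
  omega

/-- Pulled back by `w_T`, consecutive entries become positions in the row reading, whose blocks are
the rows in order. Being in increasing order and in different blocks means that the row increases.
-/
theorem simpleRootMem_iff (T : Tableau beta) (i : ℕ) (h : i + 1 < ∑ a, beta a) :
    SimpleRootMem (tableauPerm T) i ↔ rowWord T ⟨i, by omega⟩ < rowWord T ⟨i + 1, h⟩ := by
  have hp : ∀ j, (baseTableau beta).symm ((tableauPerm T).symm j) = T.symm j := fun j => by
    simp [tableauPerm]
  have key : SimpleRootMem (tableauPerm T) i ↔
      ((tableauPerm T).symm ⟨i, by omega⟩, (tableauPerm T).symm ⟨i + 1, h⟩) ∈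
        outerPosRoots beta := by
    constructor
    · rintro ⟨_, ⟨a, b⟩, hab, heq⟩
      rw [Prod.map_apply, Prod.mk.injEq] at heq
      rw [← heq.1, ← heq.2, Equiv.symm_apply_apply, Equiv.symm_apply_apply]
      exact hab
    · exact fun hr => ⟨h, _, hr, by simp⟩
  rw [key]
  simp only [outerPosRoots, Set.mem_ofPred_eq, hp, rowWord]
  have hlt : (tableauPerm T).symm ⟨i, by omega⟩ < (tableauPerm T).symm ⟨i + 1, h⟩ ↔
      baseTableau beta (T.symm ⟨i, by omega⟩) < baseTableau beta (T.symm ⟨i + 1, h⟩) := by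
    rw [← hp, ← hp, Equiv.apply_symm_apply, Equiv.apply_symm_apply]
  rw [hlt]
  constructor
  · rintro ⟨h1, h2⟩
    refine lt_of_le_of_ne (le_of_not_gt fun h3 => ?_) h2
    exact lt_asymm h1 (baseTableau_lt h3)
  · exact fun h1 => ⟨baseTableau_lt h1, h1.ne⟩

theorem dStat_eq_energy (T : Tableau beta) {a : Fin m} (ha : (a : ℕ) + 1 = m) :
    dStat T = (energy a (rowWord T) : ℤ) := by
  refine energy_eq_sum ha (rowWord T) (eta (tableauPerm T)) rfl fun i h => ?_
  rw [eta, etaPairing]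
  simp only [simpleRootMem_iff T i h]
  split_ifs <;> ring

theorem strictMono_fin_of_lt_succ {n : ℕ} {α : Type*} [Preorder α] {f : Fin n → α}
    (hf : ∀ k k' : Fin n, (k' : ℕ) = k + 1 → f k < f k') : StrictMono f := by
  cases n with
  | zero => exact fun k => k.elim0
  | succ n => exact Fin.strictMono_iff_lt_succ.mpr fun i => hf _ _ (by simp)

/-- The word gives the set of entries of each row, and an increasing row is determined by that set.
-/
theorem rowWord_strictMono_ext {T T' : Tableau beta}
    (hT : ∀ a, StrictMono fun k => T ⟨a, k⟩) (hT' : ∀ a, StrictMono fun k => T' ⟨a, k⟩)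
    (h : rowWord T = rowWord T') : T = T' := by
  have hr : ∀ (S : Tableau beta) a, Set.range (fun k => S ⟨a, k⟩) = {i | rowWord S i = a} := by
    intro S a
    ext i
    constructor
    · rintro ⟨k, rfl⟩; exact rowWord_apply S _
    · rintro rfl; exact ⟨(S.symm i).2, S.apply_symm_apply i⟩
  ext1 ⟨a, k⟩
  exact congrFun (((hT a).range_inj (hT' a)).mp (by rw [hr, hr, h])) k

/-- A word with content `β` is the word of a tableau with increasing rows. -/
theorem exists_tableau (v : Fin (∑ a, beta a) → Fin m)
    (hv : ∀ a, letterCount v (∑ b, beta b) a = beta a) :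
    ∃ T : Tableau beta, (∀ a, StrictMono fun k => T ⟨a, k⟩) ∧ rowWord T = v := by
  let s : Fin m → Finset (Fin (∑ a, beta a)) := fun a =>
    Finset.univ.filter fun i => (i : ℕ) < ∑ b, beta b ∧ v i = a
  let f : Cell beta → Fin (∑ a, beta a) := fun x => (s x.1).orderEmbOfFin (hv x.1) x.2
  have hf : ∀ x, v (f x) = x.1 := fun x =>
    (Finset.mem_filter.mp (Finset.orderEmbOfFin_mem (s x.1) (hv x.1) x.2)).2.2
  have hinj : Function.Injective f := by
    rintro ⟨a, k⟩ ⟨b, j⟩ h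
    have hab : a = b := (hf ⟨a, k⟩).symm.trans ((congrArg v h).trans (hf ⟨b, j⟩))
    subst hab
    exact congrArg (Sigma.mk a) (((s a).orderEmbOfFin (hv a)).injective h)
  have hbij : Function.Bijective f :=
    (Fintype.bijective_iff_injective_and_card f).mpr ⟨hinj, by simp⟩
  refine ⟨Equiv.ofBijective f hbij, fun a => ((s a).orderEmbOfFin (hv a)).strictMono, ?_⟩
  funext i
  obtain ⟨x, rfl⟩ := hbij.2 i
  rw [hf]
  exact rowWord_apply (Equiv.ofBijective f hbij) x

theorem rowCount_succ_of_strictMono {T : Tableau beta} (a : Fin m)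
    (hT : StrictMono fun k => T ⟨a, k⟩) (k : Fin (beta a)) :
    rowCount T (T ⟨a, k⟩ + 1) a = k + 1 := by
  rw [rowCount, Nat.card_eq_fintype_card, Fintype.card_subtype]
  have : (Finset.univ.filter fun j : Fin (beta a) => (T ⟨a, j⟩ : ℕ) + 1 ≤ T ⟨a, k⟩ + 1) =
      Finset.Iic k := by
    ext j
    simp only [Finset.mem_filter, Finset.mem_univ, true_and, Finset.mem_Iic, add_le_add_iff_right]
    exact hT.le_iff_le
  rw [this, Fin.card_Iic]

theorem rowCount_le_of_strictMono {T : Tableau beta} (a : Fin m)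
    (hT : StrictMono fun k => T ⟨a, k⟩) (k : Fin (beta a)) {n : ℕ} (hn : n ≤ T ⟨a, k⟩) :
    rowCount T n a ≤ k := by
  rw [rowCount, Nat.card_eq_fintype_card, Fintype.card_subtype, ← Fin.card_Iio k]
  refine Finset.card_le_card fun j hj => ?_
  simp only [Finset.mem_filter, Finset.mem_univ, true_and] at hj
  rw [Finset.mem_Iio]
  refine hT.lt_iff_lt.mp ?_
  rw [Fin.lt_def]
  omega

theorem tableauWeight_cElt (l : ℂ) (mu : Weight m) (T : Tableau beta) (n : ℕ) :
    tableauWeight l mu T n (cElt m) = l := by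
  rw [tableauWeight, LinearMap.add_apply, LinearMap.sum_apply, Finset.sum_eq_zero]
  · simp
  · intro a _
    rw [LinearMap.smul_apply, eBar_cElt, smul_zero]

/-! ### Restricted tableaux as dominant paths -/

variable [NeZero m]

theorem classical_tableauWeight (l : ℂ) (mu : Weight m) (T : Tableau beta) (n : ℕ) :
    classical (tableauWeight l mu T n) =
      classical mu + ∑ a, (rowCount T n a : ℂ) • finE a := by
  rw [tableauWeight, classical_add, classical_smul, classical_cStar, classical_sum, smul_zero,
    add_zero]
  simp only [classical_smul, classical_eBar]
  simp only [sub_smul, add_smul, Finset.sum_sub_distrib,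
    Finset.sum_add_distrib, ← Finset.smul_sum, sum_finE, smul_zero, sub_zero]
  congr 1
  exact (finWeight_eq_sum (classical mu)).symm

theorem dominantIntegral_iff (hm : 2 ≤ m) {l : ℂ} {x : Weight m} (hl : x (cElt m) = l) :
    x ∈ dominantIntegral m l ↔ IsStrictlyDominant (x + rho m) := by
  simp only [dominantIntegral, Set.mem_ofPred_eq, hl, true_and, IsStrictlyDominant,
    LinearMap.add_apply, rho_simpleCoroot hm, add_left_inj]

/-- Dominance depends only on the classical part and the level, so it does not matter that
`tableauWeight` forgets the value of `μ` at `d`. -/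
theorem tableauWeight_mem_iff (hm : 2 ≤ m) {l : ℂ} {mu : Weight m} (hl : mu (cElt m) = l)
    (T : Tableau beta) (n : ℕ) :
    tableauWeight l mu T n ∈ dominantIntegral m l ↔
      IsStrictlyDominant (position (mu + rho m) (rowWord T) n) := by
  rw [dominantIntegral_iff hm (tableauWeight_cElt l mu T n)]
  have hc : (tableauWeight l mu T n + rho m) (cElt m) =
      position (mu + rho m) (rowWord T) n (cElt m) := by
    rw [position_cElt, LinearMap.add_apply, LinearMap.add_apply, tableauWeight_cElt, hl]
  refine forall_congr' fun i => ?_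
  rw [apply_simpleCoroot, apply_simpleCoroot (position _ _ _), hc, classical_position,
    classical_add, classical_add, classical_tableauWeight, add_right_comm (classical mu)]
  simp only [rowCount_eq]

/-- The column condition follows from dominance of the intermediate weights, leaving only the rows.
-/
theorem isStandard_iff {l : ℂ} {mu : Weight m} {T : Tableau beta}
    (h : ∀ n : ℕ, 1 ≤ n → n ≤ ∑ a, beta a → tableauWeight l mu T n ∈ dominantIntegral m l) :
    IsStandard mu T ↔ ∀ a, StrictMono fun k => T ⟨a, k⟩ := by
  constructor
  · intro hT a
    refine strictMono_fin_of_lt_succ fun k k' hk => hT.1 ⟨a, k⟩ ⟨a, k'⟩ rfl ?_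
    simp only [Cell.col, hk]
    push_cast; ring
  · intro hT
    constructor
    · rintro ⟨a, k⟩ ⟨b, k'⟩ hab hcol
      obtain rfl : b = a := hab
      refine hT b (Fin.lt_def.mpr ?_)
      simp only [Cell.col] at hcol
      have : ((k' : ℕ) : ℂ) = ((k + 1 : ℕ) : ℂ) := by
        push_cast; linear_combination hcol
      have := Nat.cast_injective this
      omega
    · rintro ⟨a, k⟩ ⟨b, k'⟩ hab hcol
      simp only [Cell.col] at hab hcol
      by_contra hlt
      -- At the moment the lower cell is filled, row `b` has `k' + 1` cells and row `a` at most `k`.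
      -- As the two columns agree, the value on the coroot with index `b` would be negative.
      set n := (T ⟨b, k'⟩ : ℕ) + 1 with hn
      have hne : T ⟨a, k⟩ ≠ T ⟨b, k'⟩ := fun he => by
        have := congrArg Sigma.fst (T.injective he)
        simp only at this
        rw [this] at hab; omega
      have hle : n ≤ T ⟨a, k⟩ :=
        Fin.lt_def.mp (lt_of_le_of_ne (not_lt.mp hlt) hne.symm)
      have h1 := rowCount_succ_of_strictMono b (hT b) k'
      have h2 := rowCount_le_of_strictMono a (hT a) k hle
      rw [← hn] at h1
      obtain ⟨q, hq⟩ := (h n (by omega) (by omega)).2 b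
      have hb0 : b ≠ 0 := by rintro rfl; simp at hab
      have hb1 : b - 1 = a := by
        rw [Fin.ext_iff, Fin.val_sub_one_of_ne_zero hb0, hab]; omega
      have h3 : ∀ c, finCoord (classical mu + ∑ a, (rowCount T n a : ℂ) • finE a) c =
          coord mu c + (rowCount T n c - (∑ a, (rowCount T n a : ℂ)) / m) := by
        intro c
        have := finCoord_sum (fun a => (rowCount T n a : ℂ)) c
        rw [← this]; rfl
      rw [apply_simpleCoroot', if_neg hb0, hb1, classical_tableauWeight, h3, h3, h1] at hq
      have h4 : ((rowCount T n a : ℕ) : ℂ) = ((k + 1 + q : ℕ) : ℂ) := by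
        push_cast at hq ⊢
        linear_combination hq + hcol
      have h5 := Nat.cast_injective h4
      omega

theorem bijOn_rowWord (hm : 2 ≤ m) {l : ℂ} {lam mu : Weight m} (hl : mu (cElt m) = l)
    (hbeta : IsComposition (∑ a, beta a) lam mu beta) :
    Set.BijOn rowWord (restrictedTableaux l mu beta)
      (dominantWords (lam + rho m) (mu + rho m) (∑ a, beta a)) := by
  refine ⟨?_, ?_, ?_⟩
  · rintro T ⟨-, hT⟩
    refine ⟨fun k h1 h2 => (tableauWeight_mem_iff hm hl T k).mp (hT k h1 h2), ?_⟩
    rw [classical_position]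
    simp only [letterCount_rowWord]
    rw [← hbeta.2, classical_add, classical_add]
    abel
  · rintro T ⟨hs, hT⟩ T' ⟨hs', hT'⟩ h
    exact rowWord_strictMono_ext ((isStandard_iff hT).mp hs) ((isStandard_iff hT').mp hs') h
  · rintro v ⟨hv, hv'⟩
    have h1 : HasContent (∑ a, beta a) (classical lam - classical mu)
        (letterCount v (∑ a, beta a)) := by
      refine ⟨sum_letterCount v, ?_⟩
      rw [classical_position, classical_add, classical_add] at hv'
      rw [sub_eq_iff_eq_add]
      refine add_right_cancel (b := classical (rho m)) ?_
      rw [hv']; abel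
    -- The endpoint of the path forces the content of the word to be `β`.
    obtain ⟨T, hT, rfl⟩ := exists_tableau v (congrFun (h1.unique hbeta))
    have h2 : ∀ n : ℕ, 1 ≤ n → n ≤ ∑ a, beta a →
        tableauWeight l mu T n ∈ dominantIntegral m l :=
      fun n h1 h2 => (tableauWeight_mem_iff hm hl T n).mpr (hv n h1 h2)
    exact ⟨T, ⟨(isStandard_iff h2).mpr hT, h2⟩, rfl⟩

theorem generatingFunction_eq_pathSum (hm : 2 ≤ m) {l : ℂ} {lam mu : Weight m}
    (hl : mu (cElt m) = l) (hbeta : IsComposition (∑ a, beta a) lam mu beta)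
    {a : Fin m} (ha : (a : ℕ) + 1 = m) :
    generatingFunction l mu beta =
      pathSum (lam + rho m) (∑ a, beta a) (mu + rho m) a := by
  classical
  rw [generatingFunction, finsum_mem_eq_of_bijOn (g := fun v => RatFunc.X ^ energy a v) rowWord
    (bijOn_rowWord hm hl hbeta) fun T _ => by rw [dStat_eq_energy T ha, zpow_natCast],
    pathSum_eq_sum, finsum_mem_def, finsum_eq_sum_of_fintype]
  rfl

end Tableaux

end AffineSl

end

theorem mainTheorem9 (m : ℕ) [NeZero m] (hm : 2 ≤ m) (N : ℕ) (l : ℂ)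
    (lam mu : AffineSl.Weight m)
    (hlam : lam ∈ AffineSl.dominantIntegral m l) (hmu : mu ∈ AffineSl.dominantIntegral m l)
    (beta : Fin m → ℕ) (hbeta : AffineSl.IsComposition N lam mu beta) :
    -- only finitely many terms of the sum over the Weyl group are nonzero
    (Function.support fun w : AffineSl.weylGroup m =>
      AffineSl.qMultinomial N (AffineSl.dot w lam) mu).Finite ∧
    -- the exponents `λ(d) - (w ∘ λ)(d)` are integers `e w`
    ∃ e : AffineSl.weylGroup m → ℤ,
      (∀ w, ((e w : ℤ) : ℂ) = lam (AffineSl.dElt m) - AffineSl.dot w lam (AffineSl.dElt m)) ∧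
      AffineSl.generatingFunction l mu beta =
        ∑ᶠ w : AffineSl.weylGroup m,
          (-1 : RatFunc ℚ) ^ AffineSl.length w * (RatFunc.X : RatFunc ℚ) ^ e w *
            AffineSl.qMultinomial N (AffineSl.dot w lam) mu := by
  open AffineSl in
  have hx := (dominantIntegral_iff hm hlam.1).mp hlam
  have hy := (dominantIntegral_iff hm hmu.1).mp hmu
  have hc : (lam + rho m) (cElt m) = (mu + rho m) (cElt m) := by
    rw [LinearMap.add_apply, LinearMap.add_apply, hlam.1, hmu.1]
  -- No letter exceeds the last one, so in front of a word it creates no ascent and the refined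
  -- multinomial is the ordinary one.
  let a : Fin m := ⟨m - 1, by omega⟩
  have ha : (a : ℕ) + 1 = m := by simp only [a]; omega
  have hq : ∀ w : weylGroup m, qMultinomial N (dot w lam) mu = refinedMultinomial N
      (classical ((w : Weight m ≃ₗ[ℂ] Weight m) (lam + rho m)) - classical (mu + rho m)) a := by
    intro w
    rw [← refinedMultinomial_last _ _ ha, dot, classical_sub, classical_add mu, sub_sub,
      add_comm (classical (rho m))]
  -- These exponents belong to `λ + ρ`; they serve for the dot action because `ρ(d) = 0`.
  choose e he using fun w : weylGroup m => (weylGroup_integral hm w.2 hx.isIntegral).2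
  refine ⟨(finite_setOf_hasContent hm hx N (classical (mu + rho m))).subset fun w hw => ?_,
    e, fun w => ?_, ?_⟩
  · by_contra h
    exact hw ((hq w).trans (refinedMultinomial_eq_zero h a))
  · rw [he, dot, LinearMap.add_apply, LinearMap.sub_apply, rho_dElt, add_zero, sub_zero]
  · obtain rfl : ∑ a, beta a = N := hbeta.1
    rw [generatingFunction_eq_pathSum hm hmu.1 hbeta ha,
      pathSum_eq_alternatingSum hm hx e he _ _ hy hc, alternatingSum]
    refine finsum_congr fun w => ?_
    rw [hq, sign]
    push_cast
    rfl
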